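/- Let $T>0$, $\ell>0$, $X=[0,\ell]$ and $p\in[1,\infty)$. Let $v\in C^1([0,T]\times\mathbb{R};\mathbb{R}_{>0})$, and let $b,d\in C^1(X;X)$ with $b\le d$. Given constants $0<\lambda_{\min}\le\lambda_{\max}$ and $L\ge 0$, let $\Lambda$ be the set of all $\lambda\in C([0,T]\times X\times\mathbb{R}_{\ge0};\mathbb{R})$ such that $\lambda_{\min}\le\lambda\le\lambda_{\max}$ and $$|\lambda(t,x,y)-\lambda(\tilde t,\tilde x,\tilde y)|\le L\big(|x-\tilde x|+|y-\tilde y|+|t-\tilde t|\big)$$ for all $t,\tilde t\in[0,T]$, $x,\tilde x\in X$, $y,\tilde y\in\mathbb{R}_{>0}$. Given $\rho_0,q_0\in L^\infty(X)$ and $u^1,u^2\in L^\infty((0,T))$ with $\rho_0\ge0$ and $u^1\ge0$ almost everywhere, consider for $\lambda\in\Lambda$ the system for the density $\rho$ of background traffic and the density $q$ of trucks $$\partial_t\rho(t,x)+\partial_x\Big(v\Big(t,\int_X\rho(t,s)\,ds\Big)\rho(t,x)\Big)=0,\qquad \partial_t q(t,x)+\partial_x\Big(\lambda\Big(t,x,\int_{b(x)}^{d(x)}\rho(t,s)\,ds\Big)q(t,x)\Big)=0$$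 on $(0,T)\times X$, with initial conditions $\rho(0,x)=\rho_0(x)$, $q(0,x)=q_0(x)$ for $x\in X$ and boundary conditions $$v\Big(t,\int_X\rho(t,s)\,ds\Big)\rho(t,0)=u^1(t),\qquad \lambda\Big(t,0,\int_{b(0)}^{d(0)}\rho(t,s)\,ds\Big)q(t,0)=u^2(t),\qquad t\in(0,T).$$ A weak solution is a pair $\rho,q\in C([0,T];L^p(X))$ such that for every $\varphi\in C^1$ with compact support in $[0,T)\times[0,\ell)$ and for $(r,c,r_0,u)$ equal to $\big(\rho,\;v(t,\int_X\rho(t,s)\,ds),\;\rho_0,\;u^1\big)$ and to $\big(q,\;\lambda(t,x,\int_{b(x)}^{d(x)}\rho(t,s)\,ds),\;q_0,\;u^2\big)$, $$\int_0^T\!\!\int_X r\,\big(\partial_t\varphi+c\,\partial_x\varphi\big)\,dx\,dt+\int_X r_0(x)\varphi(0,x)\,dx+\int_0^T u(t)\varphi(t,0)\,dt=0.$$ Theorem (well-posedness of the PDE system). For every $\lambda\in\Lambda$ and all such data the system has exactly one weak solution $(\rho,q)$ with $\rho,q\in C([0,T];L^p(X))$. Both $\rho$ and $q$ are essentially bounded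 on $(0,T)\times X$. Moreover $\rho\ge0$, and $q\ge0$ whenever $q_0\ge0$ and $u^2\ge0$ almost everywhere. -/

import Mathlib

open MeasureTheory Set
open scoped ENNReal

/-- The space `L^p(X)` over the road `X = [0, ℓ]`, with Lebesgue measure. -/
abbrev RoadLp (ℓ : ℝ) (p : ℝ≥0∞) : Type :=
  Lp ℝ p (volume.restrict (Icc (0 : ℝ) ℓ))

/-- The set of admissible truck speeds `λ(t, x, y)`, `(t, x, y) ∈ [0, T] × [0, ℓ] × [0, ∞)`:
continuous, between `lmin` and `lmax`, and Lipschitz with constant `L` for the `ℓ¹` distance.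
Values outside `[0, T] × [0, ℓ] × [0, ∞)` are irrelevant. -/
def admissibleSpeeds (T ℓ lmin lmax L : ℝ) : Set (ℝ → ℝ → ℝ → ℝ) :=
  {lam |
    ContinuousOn (fun z : ℝ × ℝ × ℝ => lam z.1 z.2.1 z.2.2)
      (Icc 0 T ×ˢ (Icc 0 ℓ ×ˢ Ici 0)) ∧
    (∀ t ∈ Icc 0 T, ∀ x ∈ Icc 0 ℓ, ∀ y ∈ Ici (0 : ℝ),
      lmin ≤ lam t x y ∧ lam t x y ≤ lmax) ∧
    (∀ t ∈ Icc 0 T, ∀ t' ∈ Icc 0 T, ∀ x ∈ Icc 0 ℓ, ∀ x' ∈ Icc 0 ℓ,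
      ∀ y ∈ Ioi (0 : ℝ), ∀ y' ∈ Ioi (0 : ℝ),
      |lam t x y - lam t' x' y'| ≤ L * (|x - x'| + |y - y'| + |t - t'|))}

/-- Test functions: restricted to `[0, T] × [0, ℓ]` these are the `C¹` functions with compact
support in `[0, T) × [0, ℓ)`; they need not vanish at `t = 0` or at `x = 0`.
The first coordinate is time, the second one is space. -/
def IsTestFunction (T ℓ : ℝ) (φ : ℝ × ℝ → ℝ) : Prop :=
  ContDiff ℝ 1 φ ∧ tsupport φ ⊆ Iio T ×ˢ Iio ℓ

/-- `r` satisfies, in the weak sense, the conservation law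
`∂ₜ r + ∂ₓ (c r) = 0` on `(0, T) × (0, ℓ)`, with initial condition `r(0, x) = r₀(x)` and inflow
condition `c(t, 0) r(t, 0) = u(t)`. -/
def SatisfiesWeakly {p : ℝ≥0∞} (T ℓ : ℝ) (c : ℝ → ℝ → ℝ) (r₀ u : ℝ → ℝ)
    (r : ℝ → RoadLp ℓ p) : Prop :=
  ∀ φ : ℝ × ℝ → ℝ, IsTestFunction T ℓ φ →
    (∫ t in (0 : ℝ)..T, ∫ x in (0 : ℝ)..ℓ,
        r t x * (fderiv ℝ φ (t, x) (1, 0) + c t x * fderiv ℝ φ (t, x) (0, 1)))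
      + (∫ x in (0 : ℝ)..ℓ, r₀ x * φ (0, x))
      + (∫ t in (0 : ℝ)..T, u t * φ (t, 0)) = 0

/-- `(ρ, q)` is a weak solution in `C([0, T]; L^p(X))` of the coupled system, `X = [0, ℓ]`:
* background traffic, with speed `v(t, ∫_X ρ(t, s) ds)`, initial density `ρ₀`, inflow `u₁`;
* trucks, with speed `λ(t, x, ∫_{b(x)}^{d(x)} ρ(t, s) ds)`, initial density `q₀`, inflow `u₂`.

As functions of time `ρ` and `q` matter only on `[0, T]`. -/
structure IsWeakSolution {p : ℝ≥0∞} [Fact (1 ≤ p)] (T ℓ : ℝ) (v : ℝ → ℝ → ℝ)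
    (lam : ℝ → ℝ → ℝ → ℝ) (b d ρ₀ q₀ u₁ u₂ : ℝ → ℝ) (ρ q : ℝ → RoadLp ℓ p) : Prop where
  continuous_traffic : ContinuousOn ρ (Icc 0 T)
  continuous_truck : ContinuousOn q (Icc 0 T)
  traffic : SatisfiesWeakly T ℓ (fun t _ => v t (∫ s in (0 : ℝ)..ℓ, ρ t s)) ρ₀ u₁ ρ
  truck : SatisfiesWeakly T ℓ (fun t x => lam t x (∫ s in (b x)..(d x), ρ t s)) q₀ u₂ q

/-- Essential boundedness over space and time. For `r ∈ C([0, T]; L^p(X))` a bound at almost every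
time holds at every time. -/
def IsEssBounded {p : ℝ≥0∞} (T ℓ : ℝ) (r : ℝ → RoadLp ℓ p) : Prop :=
  ∃ M : ℝ, ∀ t ∈ Icc 0 T, ∀ᵐ x ∂(volume.restrict (Icc (0 : ℝ) ℓ)), |r t x| ≤ M

namespace RoadTraffic
open Filter Topology

/-- Continuity on `[0, T]` with values in `L¹(0, ℓ)`, for a family of representatives. -/
def ContinuousInL1 (T ℓ : ℝ) (r : ℝ → ℝ → ℝ) : Prop :=
  ∀ s ∈ Icc 0 T, IntervalIntegrable (r s) volume 0 ℓ ∧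
    Tendsto (fun t => ∫ x in (0 : ℝ)..ℓ, |r t x - r s x|) (𝓝[Icc 0 T] s) (𝓝 0)

variable {T ℓ : ℝ}

lemma ContinuousInL1.of_bound (hℓ : 0 ≤ ℓ) {r : ℝ → ℝ → ℝ} {B : ℝ → ℝ → ℝ}
    (hr : ∀ s ∈ Icc 0 T, IntervalIntegrable (r s) volume 0 ℓ)
    (hB : ∀ s ∈ Icc 0 T, Tendsto (B s) (𝓝[Icc 0 T] s) (𝓝 0))
    (h : ∀ s ∈ Icc 0 T, ∀ t ∈ Icc 0 T, ∫ x in (0 : ℝ)..ℓ, |r t x - r s x| ≤ B s t) :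
    ContinuousInL1 T ℓ r := fun s hs =>
  ⟨hr s hs, squeeze_zero' (Eventually.of_forall fun _ =>
      intervalIntegral.integral_nonneg hℓ fun _ _ => abs_nonneg _)
    (eventually_mem_nhdsWithin.mono fun t ht => h s hs t ht) (hB s hs)⟩

lemma ContinuousInL1.sub (hℓ : 0 ≤ ℓ) {r f : ℝ → ℝ → ℝ} (hr : ContinuousInL1 T ℓ r)
    (hf : ContinuousInL1 T ℓ f) : ContinuousInL1 T ℓ (fun t x => r t x - f t x) := by
  refine .of_bound hℓ (B := fun s t => (∫ x in (0 : ℝ)..ℓ, |r t x - r s x|)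
    + ∫ x in (0 : ℝ)..ℓ, |f t x - f s x|) (fun s hs => (hr s hs).1.sub (hf s hs).1)
    (fun s hs => by simpa using (hr s hs).2.add (hf s hs).2) fun s hs t ht => ?_
  have h1 := ((hr t ht).1.sub (hr s hs).1).abs
  have h2 := ((hf t ht).1.sub (hf s hs).1).abs
  rw [← intervalIntegral.integral_add h1 h2]
  refine intervalIntegral.integral_mono_on hℓ
    (((hr t ht).1.sub (hf t ht).1).sub ((hr s hs).1.sub (hf s hs).1)).abs (h1.add h2)
    fun x _ => ?_
  rw [show r t x - f t x - (r s x - f s x) = (r t x - r s x) - (f t x - f s x) by ring]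
  exact abs_sub _ _

lemma continuousOn_section {c : ℝ → ℝ → ℝ}
    (hc : ContinuousOn (fun z : ℝ × ℝ => c z.1 z.2) (Icc 0 T ×ˢ Icc 0 ℓ)) {t : ℝ}
    (ht : t ∈ Icc 0 T) : ContinuousOn (c t) (Icc 0 ℓ) :=
  hc.comp (f := fun x => (t, x)) (by fun_prop) fun _ hx => ⟨ht, hx⟩

lemma exists_bound_on_rectangle {c : ℝ → ℝ → ℝ}
    (hc : ContinuousOn (fun z : ℝ × ℝ => c z.1 z.2) (Icc 0 T ×ˢ Icc 0 ℓ)) :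
    ∃ C, 0 ≤ C ∧ ∀ t ∈ Icc 0 T, ∀ x ∈ Icc 0 ℓ, |c t x| ≤ C := by
  obtain ⟨C, hC⟩ := (isCompact_Icc.prod isCompact_Icc).exists_bound_of_continuousOn hc
  exact ⟨max C 0, le_max_right _ _, fun t ht x hx =>
    (hC (t, x) ⟨ht, hx⟩).trans (le_max_left _ _)⟩

lemma intervalIntegrable_continuousOn_mul (hℓ : 0 ≤ ℓ) {c r : ℝ → ℝ}
    (hc : ContinuousOn c (Icc 0 ℓ)) (hr : IntervalIntegrable r volume 0 ℓ) :
    IntervalIntegrable (fun x => c x * r x) volume 0 ℓ :=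
  hr.continuousOn_mul (by rwa [uIcc_of_le hℓ])

lemma ContinuousInL1.mul_left (hℓ : 0 ≤ ℓ) {c r : ℝ → ℝ → ℝ}
    (hc : ContinuousOn (fun z : ℝ × ℝ => c z.1 z.2) (Icc 0 T ×ˢ Icc 0 ℓ))
    (hr : ContinuousInL1 T ℓ r) : ContinuousInL1 T ℓ (fun t x => c t x * r t x) := by
  obtain ⟨C, hC0, hC⟩ := exists_bound_on_rectangle hc
  refine .of_bound hℓ (B := fun s t => C * (∫ x in (0 : ℝ)..ℓ, |r t x - r s x|)
    + ∫ x in (0 : ℝ)..ℓ, |c t x - c s x| * |r s x|)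
    (fun s hs => intervalIntegrable_continuousOn_mul hℓ (continuousOn_section hc hs) (hr s hs).1)
    (fun s hs => ?_) fun s hs t ht => ?_
  · have key : Tendsto (fun t => ∫ x in (0 : ℝ)..ℓ, |c t x - c s x| * |r s x|)
        (𝓝[Icc 0 T] s) (𝓝 (∫ x in (0 : ℝ)..ℓ, (0 : ℝ))) := by
      refine intervalIntegral.tendsto_integral_filter_of_dominated_convergence
        (fun x => 2 * C * |r s x|) ?_ ?_ ((hr s hs).1.abs.const_mul _) ?_
      · filter_upwards [self_mem_nhdsWithin] with t ht
        rw [uIoc_of_le hℓ]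
        refine AEStronglyMeasurable.mul ?_ ?_
        · exact (((continuousOn_section hc ht).sub (continuousOn_section hc hs)).abs.mono
            Ioc_subset_Icc_self).aestronglyMeasurable measurableSet_Ioc
        · simpa [uIoc_of_le hℓ] using! (hr s hs).1.abs.aestronglyMeasurable
      · filter_upwards [self_mem_nhdsWithin] with t ht
        refine Eventually.of_forall fun x hx => ?_
        rw [uIoc_of_le hℓ] at hx
        have hx' := Ioc_subset_Icc_self hx
        rw [Real.norm_eq_abs, abs_mul, abs_abs, abs_abs]
        gcongr
        exact (abs_sub _ _).trans (by linarith [hC t ht x hx', hC s hs x hx'])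
      · refine Eventually.of_forall fun x hx => ?_
        rw [uIoc_of_le hℓ] at hx
        have hx' := Ioc_subset_Icc_self hx
        have h1 : ContinuousWithinAt (fun t => c t x) (Icc 0 T) s :=
          (hc.comp (f := fun t => (t, x)) (by fun_prop) fun _ ht => ⟨ht, hx'⟩) s hs
        have h2 : ContinuousWithinAt (fun t => |c t x - c s x| * |r s x|) (Icc 0 T) s :=
          ((h1.sub continuousWithinAt_const).abs).mul continuousWithinAt_const
        simpa [ContinuousWithinAt] using h2
    simpa using ((hr s hs).2.const_mul C).add key
  · have h1 := (((hr t ht).1.sub (hr s hs).1).abs).const_mul C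
    have h2 : IntervalIntegrable (fun x => |c t x - c s x| * |r s x|) volume 0 ℓ :=
      intervalIntegrable_continuousOn_mul hℓ
        ((continuousOn_section hc ht).sub (continuousOn_section hc hs)).abs (hr s hs).1.abs
    rw [← intervalIntegral.integral_const_mul, ← intervalIntegral.integral_add h1 h2]
    refine intervalIntegral.integral_mono_on hℓ
      ((intervalIntegrable_continuousOn_mul hℓ (continuousOn_section hc ht) (hr t ht).1).sub
        (intervalIntegrable_continuousOn_mul hℓ (continuousOn_section hc hs) (hr s hs).1)).abs
      (h1.add h2) fun x hx => ?_
    rw [show c t x * r t x - c s x * r s x = c t x * (r t x - r s x) + (c t x - c s x) * r s x by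
      ring]
    refine (abs_add_le _ _).trans ?_
    rw [abs_mul, abs_mul]
    gcongr
    exact hC t ht x hx

lemma ContinuousInL1.continuousOn_integral (hℓ : 0 ≤ ℓ) {r : ℝ → ℝ → ℝ}
    (hr : ContinuousInL1 T ℓ r) :
    ContinuousOn (fun t => ∫ x in (0 : ℝ)..ℓ, r t x) (Icc 0 T) := by
  intro s hs
  rw [ContinuousWithinAt, tendsto_iff_dist_tendsto_zero]
  refine squeeze_zero' (Eventually.of_forall fun _ => dist_nonneg)
    (eventually_mem_nhdsWithin.mono fun t ht => ?_) (hr s hs).2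
  rw [Real.dist_eq, ← intervalIntegral.integral_sub (hr t ht).1 (hr s hs).1]
  exact intervalIntegral.abs_integral_le_integral_abs hℓ

lemma ContinuousInL1.abs (hℓ : 0 ≤ ℓ) {r : ℝ → ℝ → ℝ} (hr : ContinuousInL1 T ℓ r) :
    ContinuousInL1 T ℓ (fun t x => |r t x|) :=
  .of_bound hℓ (fun s hs => (hr s hs).1.abs) (fun s hs => (hr s hs).2) fun s hs t ht =>
    intervalIntegral.integral_mono_on hℓ ((hr t ht).1.abs.sub (hr s hs).1.abs).abs
      ((hr t ht).1.sub (hr s hs).1).abs fun _ _ => abs_abs_sub_abs_le _ _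

lemma ContinuousInL1.mul_const (hℓ : 0 ≤ ℓ) {r : ℝ → ℝ → ℝ} (hr : ContinuousInL1 T ℓ r)
    {γ : ℝ → ℝ} (hγ : ContinuousOn γ (Icc 0 ℓ)) : ContinuousInL1 T ℓ (fun t x => r t x * γ x) := by
  have := hr.mul_left hℓ (c := fun _ x => γ x)
    (hγ.comp (f := Prod.snd) (by fun_prop) fun z hz => hz.2)
  simpa only [mul_comm] using this

lemma IntervalIntegrable.mono_Icc (hℓ : 0 ≤ ℓ) {g : ℝ → ℝ} (hg : IntervalIntegrable g volume 0 ℓ)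
    {x y : ℝ} (hx : x ∈ Icc 0 ℓ) (hy : y ∈ Icc 0 ℓ) : IntervalIntegrable g volume x y :=
  hg.mono_set (by rw [uIcc_of_le hℓ]; exact uIcc_subset_Icc hx hy)

lemma ContinuousInL1.abs_primitive_sub_le (hℓ : 0 ≤ ℓ) {r : ℝ → ℝ → ℝ}
    (hr : ContinuousInL1 T ℓ r) {s t x : ℝ} (hs : s ∈ Icc 0 T) (ht : t ∈ Icc 0 T)
    (hx : x ∈ Icc 0 ℓ) :
    |(∫ y in (0 : ℝ)..x, r t y) - ∫ y in (0 : ℝ)..x, r s y|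
      ≤ ∫ y in (0 : ℝ)..ℓ, |r t y - r s y| := by
  have h0 : (0 : ℝ) ∈ Icc 0 ℓ := ⟨le_rfl, hℓ⟩
  rw [← intervalIntegral.integral_sub (IntervalIntegrable.mono_Icc hℓ (hr t ht).1 h0 hx)
    (IntervalIntegrable.mono_Icc hℓ (hr s hs).1 h0 hx)]
  refine (intervalIntegral.abs_integral_le_integral_abs hx.1).trans ?_
  exact intervalIntegral.integral_mono_interval le_rfl hx.1 hx.2
    (Eventually.of_forall fun _ => abs_nonneg _) ((hr t ht).1.sub (hr s hs).1).abs

lemma continuousOn_primitive (hℓ : 0 ≤ ℓ) {g : ℝ → ℝ} (hg : IntervalIntegrable g volume 0 ℓ) :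
    ContinuousOn (fun x => ∫ y in (0 : ℝ)..x, g y) (Icc 0 ℓ) := by
  have := intervalIntegral.continuousOn_primitive_interval' hg left_mem_uIcc
  rwa [uIcc_of_le hℓ] at this

lemma ContinuousInL1.continuousOn_primitive (hℓ : 0 ≤ ℓ) {r : ℝ → ℝ → ℝ}
    (hr : ContinuousInL1 T ℓ r) :
    ContinuousOn (fun z : ℝ × ℝ => ∫ y in (0 : ℝ)..z.2, r z.1 y) (Icc 0 T ×ˢ Icc 0 ℓ) := by
  rintro ⟨s, x⟩ ⟨hs, hx⟩
  have h1 : Tendsto (fun z : ℝ × ℝ => ∫ y in (0 : ℝ)..ℓ, |r z.1 y - r s y|)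
      (𝓝[Icc 0 T ×ˢ Icc 0 ℓ] (s, x)) (𝓝 0) := by
    refine (hr s hs).2.comp (tendsto_nhdsWithin_iff.2 ⟨?_, ?_⟩)
    · exact (continuous_fst.tendsto (s, x)).mono_left nhdsWithin_le_nhds
    · exact eventually_mem_nhdsWithin.mono fun z hz => hz.1
  have h2 : Tendsto (fun z : ℝ × ℝ => ∫ y in (0 : ℝ)..z.2, r s y)
      (𝓝[Icc 0 T ×ˢ Icc 0 ℓ] (s, x)) (𝓝 (∫ y in (0 : ℝ)..x, r s y)) := by
    refine Tendsto.comp (RoadTraffic.continuousOn_primitive hℓ (hr s hs).1 x hx)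
      (tendsto_nhdsWithin_iff.2 ⟨?_, ?_⟩)
    · exact (continuous_snd.tendsto (s, x)).mono_left nhdsWithin_le_nhds
    · exact eventually_mem_nhdsWithin.mono fun z hz => hz.2
  have h3 : Tendsto (fun z : ℝ × ℝ => (∫ y in (0 : ℝ)..z.2, r z.1 y) - ∫ y in (0 : ℝ)..z.2, r s y)
      (𝓝[Icc 0 T ×ˢ Icc 0 ℓ] (s, x)) (𝓝 0) :=
    squeeze_zero_norm' (eventually_mem_nhdsWithin.mono fun z hz =>
      hr.abs_primitive_sub_le hℓ hs hz.1 hz.2) h1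
  simpa [ContinuousWithinAt] using h3.add h2

variable {p : ℝ≥0∞}

lemma memLp_of_measurable_of_bound {g : ℝ → ℝ} (hg : Measurable g) {M : ℝ}
    (hM : ∀ x, |g x| ≤ M) : MemLp g p (volume.restrict (Icc (0 : ℝ) ℓ)) :=
  MemLp.of_bound hg.aestronglyMeasurable M (Eventually.of_forall hM)

variable [Fact (1 ≤ p)]

lemma intervalIntegral_eq_integral_Icc (hℓ : 0 ≤ ℓ) (f : ℝ → ℝ) :
    ∫ x in (0 : ℝ)..ℓ, f x = ∫ x in Icc 0 ℓ, f x := by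
  rw [intervalIntegral.integral_of_le hℓ, integral_Icc_eq_integral_Ioc]

lemma integrable_roadLp (f : RoadLp ℓ p) : Integrable f (volume.restrict (Icc (0 : ℝ) ℓ)) :=
  memLp_one_iff_integrable.1 ((Lp.memLp f).mono_exponent Fact.out)

lemma intervalIntegrable_iff_Icc (hℓ : 0 ≤ ℓ) {f : ℝ → ℝ} :
    IntervalIntegrable f volume 0 ℓ ↔ Integrable f (volume.restrict (Icc (0 : ℝ) ℓ)) := by
  rw [intervalIntegrable_iff_integrableOn_Icc_of_le hℓ, IntegrableOn]

lemma continuousInL1_of_continuousOn (hℓ : 0 ≤ ℓ) {r : ℝ → RoadLp ℓ p}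
    (hr : ContinuousOn r (Icc 0 T)) : ContinuousInL1 T ℓ (fun t x => r t x) := by
  intro s hs
  refine ⟨(intervalIntegrable_iff_Icc hℓ).2 (integrable_roadLp _), ?_⟩
  set μ := volume.restrict (Icc (0 : ℝ) ℓ) with hμ
  have h1 : Tendsto (fun t => eLpNorm (⇑(r t) - ⇑(r s)) p μ) (𝓝[Icc 0 T] s) (𝓝 0) :=
    (Lp.tendsto_Lp_iff_tendsto_eLpNorm' _ _).1 (hr s hs)
  have h2 : Tendsto (fun t => eLpNorm (⇑(r t) - ⇑(r s)) 1 μ) (𝓝[Icc 0 T] s) (𝓝 0) := by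
    have h3 := ENNReal.Tendsto.mul_const h1
      (b := μ univ ^ (1 / (1 : ℝ≥0∞).toReal - 1 / p.toReal)) (Or.inr ?_)
    · rw [zero_mul] at h3
      refine tendsto_of_tendsto_of_tendsto_of_le_of_le tendsto_const_nhds h3
        (fun _ => zero_le) fun t => ?_
      exact eLpNorm_le_eLpNorm_mul_rpow_measure_univ Fact.out
        ((Lp.aestronglyMeasurable _).sub (Lp.aestronglyMeasurable _))
    · refine ENNReal.rpow_ne_top_of_nonneg ?_ (measure_ne_top _ _)
      rw [ENNReal.toReal_one, sub_nonneg]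
      rcases eq_or_ne p ⊤ with rfl | hp
      · simp
      · have : 1 ≤ p.toReal := by
          simpa using ENNReal.toReal_mono hp (Fact.out : 1 ≤ p)
        gcongr
  have h4 := (ENNReal.tendsto_toReal ENNReal.zero_ne_top).comp h2
  refine h4.congr fun t => ?_
  rw [intervalIntegral_eq_integral_Icc hℓ, Function.comp, eLpNorm_one_eq_lintegral_enorm,
    ← integral_norm_eq_lintegral_enorm]
  · rfl
  · exact (Lp.aestronglyMeasurable _).sub (Lp.aestronglyMeasurable _)

lemma continuousOn_toLp_of_continuousInL1 (hp : p ≠ ⊤) (hℓ : 0 ≤ ℓ) {r : ℝ → ℝ → ℝ}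
    (hr : ContinuousInL1 T ℓ r) (hmeas : ∀ t, Measurable (r t)) {M : ℝ}
    (hM : ∀ t x, |r t x| ≤ M) :
    ContinuousOn (fun t => (memLp_of_measurable_of_bound (hmeas t) (hM t)).toLp (r t) :
      ℝ → RoadLp ℓ p) (Icc 0 T) := by
  intro s hs
  set μ := volume.restrict (Icc (0 : ℝ) ℓ) with hμ
  rw [ContinuousWithinAt, Lp.tendsto_Lp_iff_tendsto_eLpNorm'']
  have hp1 : 1 ≤ p.toReal := by simpa using ENNReal.toReal_mono hp (Fact.out : 1 ≤ p)
  have hp0 : p ≠ 0 := (zero_lt_one.trans_le Fact.out).ne'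
  have hM0 : 0 ≤ M := (abs_nonneg _).trans (hM 0 0)
  set C : ℝ≥0∞ := ENNReal.ofReal (2 * M) ^ (p.toReal - 1)
  have h1 : Tendsto (fun t => (C * ENNReal.ofReal (∫ x in (0 : ℝ)..ℓ, |r t x - r s x|))
      ^ (1 / p.toReal)) (𝓝[Icc 0 T] s) (𝓝 0) := by
    have := (ENNReal.Tendsto.const_mul (a := C) (ENNReal.tendsto_ofReal (hr s hs).2)
      (Or.inr (ENNReal.rpow_ne_top_of_nonneg (by linarith) ENNReal.ofReal_ne_top))).ennrpow_const
      (1 / p.toReal)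
    simpa [ENNReal.zero_rpow_of_pos (show 0 < p.toReal⁻¹ by positivity)] using this
  refine tendsto_of_tendsto_of_tendsto_of_le_of_le' tendsto_const_nhds h1
    (Eventually.of_forall fun _ => zero_le) ?_
  filter_upwards [self_mem_nhdsWithin] with t ht
  rw [eLpNorm_eq_lintegral_rpow_enorm_toReal hp0 hp]
  gcongr
  have hint : Integrable (fun x => r t x - r s x) μ :=
    (intervalIntegrable_iff_Icc hℓ).1 ((hr t ht).1.sub (hr s hs).1)
  rw [intervalIntegral_eq_integral_Icc hℓ, ← hμ]
  have h3 : ENNReal.ofReal (∫ x, |r t x - r s x| ∂μ) = ∫⁻ x, ‖r t x - r s x‖ₑ ∂μ :=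
    ofReal_integral_norm_eq_lintegral_enorm hint
  rw [h3, ← lintegral_const_mul C (f := fun x => ‖r t x - r s x‖ₑ) (((hmeas t).sub (hmeas s)).enorm)]
  refine lintegral_mono fun x => ?_
  have h4 : ‖r t x - r s x‖ₑ ≤ ENNReal.ofReal (2 * M) := by
    rw [Real.enorm_eq_ofReal_abs]
    exact ENNReal.ofReal_le_ofReal ((abs_sub _ _).trans (by linarith [hM t x, hM s x]))
  calc ‖(r t - r s) x‖ₑ ^ p.toReal = ‖r t x - r s x‖ₑ ^ ((p.toReal - 1) + 1) := by
        rw [sub_add_cancel]; rfl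
    _ = ‖r t x - r s x‖ₑ ^ (p.toReal - 1) * ‖r t x - r s x‖ₑ := by
        rw [ENNReal.rpow_add_of_nonneg _ _ (by linarith) zero_le_one, ENNReal.rpow_one]
    _ ≤ _ := by gcongr; exact ENNReal.rpow_le_rpow h4 (sub_nonneg.2 hp1)

end RoadTraffic

namespace RoadTraffic
open Filter Topology

variable {T ℓ : ℝ}

section TestFunctions

variable {B b' : ℝ} {γ : ℝ → ℝ}

lemma hasDerivAt_integral_of_continuous (hγ : Continuous γ) (B x : ℝ) :
    HasDerivAt (fun x => ∫ y in B..x, γ y) (γ x) x :=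
  intervalIntegral.integral_hasDerivAt_right (hγ.intervalIntegrable _ _)
    hγ.aestronglyMeasurable.stronglyMeasurableAtFilter hγ.continuousAt

lemma contDiff_integral_of_continuous (hγ : Continuous γ) (B : ℝ) :
    ContDiff ℝ 1 (fun x => ∫ y in B..x, γ y) := by
  have h : deriv (fun x => ∫ y in B..x, γ y) = γ :=
    funext fun x => (hasDerivAt_integral_of_continuous hγ B x).deriv
  rw [contDiff_one_iff_deriv, h]
  exact ⟨fun x => (hasDerivAt_integral_of_continuous hγ B x).differentiableAt, hγ⟩

lemma tsupport_integral_subset (hb : b' < B) (h0 : ∀ x, b' ≤ x → γ x = 0) :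
    tsupport (fun x => ∫ y in B..x, γ y) ⊆ Iio B := by
  refine (closure_minimal (t := Iic b') (fun x hx => ?_) isClosed_Iic).trans
    fun x hx => lt_of_le_of_lt hx hb
  by_contra hxb
  rw [mem_Iic, not_le] at hxb
  refine hx ?_
  have : ∀ y ∈ uIcc B x, γ y = 0 := fun y hy => h0 y ((le_inf hb.le hxb.le).trans hy.1)
  simp only
  rw [intervalIntegral.integral_congr (g := fun _ => 0) this, intervalIntegral.integral_zero]

lemma isTestFunction_mul {α β : ℝ → ℝ} (hα : ContDiff ℝ 1 α) (hβ : ContDiff ℝ 1 β)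
    (hα' : tsupport α ⊆ Iio T) (hβ' : tsupport β ⊆ Iio ℓ) :
    IsTestFunction T ℓ (fun z => α z.1 * β z.2) := by
  refine ⟨(hα.comp contDiff_fst).mul (hβ.comp contDiff_snd), ?_⟩
  refine Subset.trans (closure_minimal (t := tsupport α ×ˢ tsupport β) (fun z hz => ?_)
    ((isClosed_tsupport _).prod (isClosed_tsupport _))) (prod_mono hα' hβ')
  have hz' : α z.1 * β z.2 ≠ 0 := hz
  exact ⟨subset_tsupport _ (left_ne_zero_of_mul hz'), subset_tsupport _ (right_ne_zero_of_mul hz')⟩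

lemma hasFDerivAt_mul_fst_snd {α β : ℝ → ℝ} {a b t x : ℝ} (hα : HasDerivAt α a t)
    (hβ : HasDerivAt β b x) :
    fderiv ℝ (fun z : ℝ × ℝ => α z.1 * β z.2) (t, x) (1, 0) = a * β x ∧
    fderiv ℝ (fun z : ℝ × ℝ => α z.1 * β z.2) (t, x) (0, 1) = α t * b := by
  have h1 : HasFDerivAt (fun z : ℝ × ℝ => α z.1) _ (t, x) :=
    hα.hasFDerivAt.comp (t, x) hasFDerivAt_fst
  have h2 : HasFDerivAt (fun z : ℝ × ℝ => β z.2) _ (t, x) :=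
    hβ.hasFDerivAt.comp (t, x) hasFDerivAt_snd
  rw [HasFDerivAt.fderiv (h1.fun_mul h2)]
  constructor <;> simp [mul_comm]

end TestFunctions

/-- Weak form of `h' = k`, `h 0 = 0`, tested against functions vanishing near `T`. -/
lemma eq_integral_of_weak_derivative (hT : 0 < T) {h k : ℝ → ℝ} (hh : ContinuousOn h (Icc 0 T))
    (hk : ContinuousOn k (Icc 0 T))
    (H : ∀ η : ℝ → ℝ, Continuous η → (∃ b' < T, ∀ t, b' ≤ t → η t = 0) →
      ∫ t in (0 : ℝ)..T, (η t * h t + (∫ s in T..t, η s) * k t) = 0) :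
    ∀ t ∈ Icc 0 T, h t = ∫ s in (0 : ℝ)..t, k s := by
  set h' : ℝ → ℝ := IccExtend hT.le ((Icc 0 T).domRestrict h) with hh'
  set k' : ℝ → ℝ := IccExtend hT.le ((Icc 0 T).domRestrict k) with hk'
  have hh'c : Continuous h' := (continuousOn_iff_continuous_domRestrict.1 hh).Icc_extend'
  have hk'c : Continuous k' := (continuousOn_iff_continuous_domRestrict.1 hk).Icc_extend'
  have hhe : ∀ t ∈ Icc 0 T, h' t = h t := fun t ht => IccExtend_of_mem _ _ ht
  have hke : ∀ t ∈ Icc 0 T, k' t = k t := fun t ht => IccExtend_of_mem _ _ ht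
  set K : ℝ → ℝ := fun t => ∫ s in (0 : ℝ)..t, k' s with hK
  have hKd : ∀ t, HasDerivAt K (k' t) t := hasDerivAt_integral_of_continuous hk'c 0
  have hKc : Continuous K := continuous_iff_continuousAt.2 fun t => (hKd t).continuousAt
  have key : ∀ η : ℝ → ℝ, Continuous η → (∃ b' < T, ∀ t, b' ≤ t → η t = 0) →
      ∫ t in (0 : ℝ)..T, η t * (h' t - K t) = 0 := by
    intro η hη hη0
    have hαd := hasDerivAt_integral_of_continuous hη T
    have hαc : Continuous fun t => ∫ s in T..t, η s :=
      continuous_iff_continuousAt.2 fun t => (hαd t).continuousAt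
    have hparts := intervalIntegral.integral_mul_deriv_eq_deriv_mul (a := 0) (b := T)
      (fun t _ => hαd t) (fun t _ => hKd t) (hη.intervalIntegrable _ _)
      (hk'c.intervalIntegrable _ _)
    have h1 := H η hη hη0
    rw [intervalIntegral.integral_congr
      (g := fun t => η t * h' t + (∫ s in T..t, η s) * k' t) fun t ht => by
        rw [uIcc_of_le hT.le] at ht
        simp only [hhe t ht, hke t ht]] at h1
    have i1 : IntervalIntegrable (fun t => η t * h' t) volume 0 T :=
      (hη.mul hh'c).intervalIntegrable _ _
    have i2 : IntervalIntegrable (fun t => (∫ s in T..t, η s) * k' t) volume 0 T :=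
      (hαc.mul hk'c).intervalIntegrable _ _
    have i3 : IntervalIntegrable (fun t => η t * K t) volume 0 T :=
      (hη.mul hKc).intervalIntegrable _ _
    rw [intervalIntegral.integral_add i1 i2, hparts] at h1
    have hK0 : K 0 = 0 := intervalIntegral.integral_same
    simp only [intervalIntegral.integral_same, hK0, zero_mul, mul_zero, sub_zero] at h1
    simp_rw [mul_sub]
    rw [intervalIntegral.integral_sub i1 i3]
    linarith
  have hw : ∀ t ∈ Ico 0 T, h' t = K t := by
    intro t ht
    by_contra hne
    set τ := (t + T) / 2 with hτ
    have hη := key (fun s => (h' s - K s) * max 0 (τ - s)) (by fun_prop)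
      ⟨τ, by linarith [ht.2], fun s hs => by rw [max_eq_left (by linarith), mul_zero]⟩
    refine absurd hη (ne_of_gt (intervalIntegral.integral_pos hT (by fun_prop)
      (fun s _ => ?_) ⟨t, Ico_subset_Icc_self ht, ?_⟩))
    · rw [mul_right_comm]
      exact mul_nonneg (mul_self_nonneg _) (le_max_left _ _)
    · rw [mul_right_comm]
      exact mul_pos (mul_self_pos.2 (sub_ne_zero.2 hne))
        (lt_max_of_lt_right (by linarith [ht.2]))
  have hKT : EqOn h K (Icc 0 T) :=
    Set.EqOn.of_subset_closure (s := Ico 0 T)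
      (fun t ht => (hhe t (Ico_subset_Icc_self ht)).symm.trans (hw t ht)) hh hKc.continuousOn
      Ico_subset_Icc_self (by rw [closure_Ico hT.ne])
  intro t ht
  rw [hKT ht]
  refine intervalIntegral.integral_congr fun s hs => hke s ?_
  rw [uIcc_of_le ht.1] at hs
  exact ⟨hs.1, hs.2.trans ht.2⟩

end RoadTraffic

namespace RoadTraffic
open Filter Topology

variable {T ℓ : ℝ}

lemma ae_deriv_primitive_eq {g : ℝ → ℝ} (hg : IntervalIntegrable g volume 0 ℓ) :
    ∀ᵐ x, x ∈ uIoc 0 ℓ → HasDerivAt (fun x => ∫ y in (0 : ℝ)..x, g y) (g x) x := by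
  filter_upwards [hg.ae_hasDerivAt_integral] with x hx hx'
  exact hx (uIoc_subset_uIcc hx') 0 left_mem_uIcc

lemma absolutelyContinuousOnInterval_primitive {g : ℝ → ℝ}
    (hg : IntervalIntegrable g volume 0 ℓ) :
    AbsolutelyContinuousOnInterval (fun x => ∫ y in (0 : ℝ)..x, g y) 0 ℓ :=
  hg.absolutelyContinuousOnInterval_intervalIntegral left_mem_uIcc

lemma integral_mul_primitive {g γ : ℝ → ℝ} (hg : IntervalIntegrable g volume 0 ℓ)
    (hγ : Continuous γ) :
    ∫ x in (0 : ℝ)..ℓ, g x * (∫ y in ℓ..x, γ y)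
      = -∫ x in (0 : ℝ)..ℓ, (∫ y in (0 : ℝ)..x, g y) * γ x := by
  have hβ : AbsolutelyContinuousOnInterval (fun x => ∫ y in ℓ..x, γ y) 0 ℓ :=
    (contDiff_integral_of_continuous hγ ℓ).contDiffOn.absolutelyContinuousOnInterval
  have h := hβ.integral_mul_deriv_eq_deriv_mul (absolutelyContinuousOnInterval_primitive hg)
  simp only [intervalIntegral.integral_same, zero_mul, mul_zero, sub_zero, zero_sub] at h
  rw [intervalIntegral.integral_congr_ae (g := fun x => (∫ y in ℓ..x, γ y) *
    deriv (fun x => ∫ y in (0 : ℝ)..x, g y) x), h]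
  · congr 1
    refine intervalIntegral.integral_congr fun x _ => ?_
    simp only [(hasDerivAt_integral_of_continuous hγ ℓ x).deriv, mul_comm]
  · filter_upwards [ae_deriv_primitive_eq hg] with x hx hx'
    rw [(hx hx').deriv, mul_comm]

/-- The homogeneous weak form of `∂ₜ r + ∂ₓ f = 0` with vanishing initial and boundary data. -/
def WeaklyConserved (T ℓ : ℝ) (r f : ℝ → ℝ → ℝ) : Prop :=
  ∀ φ : ℝ × ℝ → ℝ, IsTestFunction T ℓ φ →
    ∫ t in (0 : ℝ)..T, ∫ x in (0 : ℝ)..ℓ,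
      (r t x * fderiv ℝ φ (t, x) (1, 0) + f t x * fderiv ℝ φ (t, x) (0, 1)) = 0

lemma integrable_of_continuousOn_Icc (hT : 0 ≤ T) {h : ℝ → ℝ} (hh : ContinuousOn h (Icc 0 T)) :
    IntervalIntegrable h volume 0 T :=
  ContinuousOn.intervalIntegrable (by rwa [uIcc_of_le hT])

variable {r f : ℝ → ℝ → ℝ}

lemma WeaklyConserved.integral_primitive_mul_of_vanishing (hT : 0 < T) (hℓ : 0 < ℓ)
    (hr : ContinuousInL1 T ℓ r) (hf : ContinuousInL1 T ℓ f) (hw : WeaklyConserved T ℓ r f)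
    {γ : ℝ → ℝ} (hγ : Continuous γ) {b' : ℝ} (hb : b' < ℓ) (h0 : ∀ x, b' ≤ x → γ x = 0) :
    ∀ t ∈ Icc 0 T, ∫ x in (0 : ℝ)..ℓ, (∫ y in (0 : ℝ)..x, r t y) * γ x
      = -∫ σ in (0 : ℝ)..t, ∫ x in (0 : ℝ)..ℓ, f σ x * γ x := by
  set β : ℝ → ℝ := fun x => ∫ y in ℓ..x, γ y with hβ
  have hβ1 : ContDiff ℝ 1 β := contDiff_integral_of_continuous hγ ℓ
  have hβd : ∀ x, HasDerivAt β (γ x) x := hasDerivAt_integral_of_continuous hγ ℓ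
  have hrβ := hr.mul_const hℓ.le hβ1.continuous.continuousOn
  have hfγ := hf.mul_const hℓ.le hγ.continuousOn
  have key := eq_integral_of_weak_derivative hT (hrβ.continuousOn_integral hℓ.le)
    (hfγ.continuousOn_integral hℓ.le) fun η hη ⟨τ, hτ, hη0⟩ => by
      refine Eq.trans ?_ (hw _ (isTestFunction_mul (contDiff_integral_of_continuous hη T) hβ1
        (tsupport_integral_subset hτ hη0) (tsupport_integral_subset hb h0)))
      refine intervalIntegral.integral_congr fun t ht => ?_
      rw [uIcc_of_le hT.le] at ht
      rw [← intervalIntegral.integral_const_mul, ← intervalIntegral.integral_const_mul,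
        ← intervalIntegral.integral_add ((hrβ t ht).1.const_mul _) ((hfγ t ht).1.const_mul _)]
      refine intervalIntegral.integral_congr fun x _ => ?_
      obtain ⟨h1, h2⟩ :=
        hasFDerivAt_mul_fst_snd (hasDerivAt_integral_of_continuous hη T t) (hβd x)
      simp only [h1, h2]
      ring
  intro t ht
  have h1 := key t ht
  rw [integral_mul_primitive (hr t ht).1 hγ] at h1
  linarith

/-- Continuous cutoffs equal to `0` near `ℓ` and converging to `1` on `(-∞, ℓ)`. -/
def cutoff (ℓ : ℝ) (n : ℕ) (x : ℝ) : ℝ := max 0 (min 1 (n * (ℓ - x) - 1))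

lemma continuous_cutoff (n : ℕ) : Continuous (cutoff ℓ n) := by unfold cutoff; fun_prop

lemma cutoff_eq_zero {n : ℕ} {x : ℝ} (hx : ℓ - 1 / ((n : ℝ) + 1) ≤ x) : cutoff ℓ n x = 0 := by
  refine max_eq_left (min_le_of_right_le ?_)
  have hn : (0 : ℝ) ≤ n := n.cast_nonneg
  have h1 : (n : ℝ) * (ℓ - x) ≤ n * (1 / ((n : ℝ) + 1)) := by gcongr; linarith
  have h2 : (n : ℝ) * (1 / ((n : ℝ) + 1)) ≤ 1 := by
    rw [mul_one_div, div_le_one (by positivity)]; linarith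
  linarith

lemma abs_cutoff_le (n : ℕ) (x : ℝ) : |cutoff ℓ n x| ≤ 1 := by
  rw [cutoff, abs_of_nonneg (le_max_left _ _)]
  exact max_le zero_le_one (min_le_left _ _)

lemma tendsto_cutoff {x : ℝ} (hx : x < ℓ) :
    Tendsto (fun n => cutoff ℓ n x) atTop (𝓝 1) := by
  have h : Tendsto (fun n : ℕ => (n : ℝ) * (ℓ - x) - 1) atTop atTop :=
    tendsto_atTop_add_const_right _ _
      (tendsto_natCast_atTop_atTop.atTop_mul_const (sub_pos.2 hx))
  refine tendsto_const_nhds.congr' ?_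
  filter_upwards [h.eventually_ge_atTop 1] with n hn
  rw [cutoff, min_eq_left hn, max_eq_right zero_le_one]

lemma tendsto_integral_mul_cutoff (hℓ : 0 ≤ ℓ) {g γ : ℝ → ℝ}
    (hg : IntervalIntegrable g volume 0 ℓ) (hγ : Continuous γ) :
    Tendsto (fun n => ∫ x in (0 : ℝ)..ℓ, g x * (γ x * cutoff ℓ n x)) atTop
      (𝓝 (∫ x in (0 : ℝ)..ℓ, g x * γ x)) := by
  have hgγ : IntervalIntegrable (fun x => g x * γ x) volume 0 ℓ := hg.mul_continuousOn hγ.continuousOn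
  refine intervalIntegral.tendsto_integral_filter_of_dominated_convergence
    (fun x => |g x * γ x|) (Eventually.of_forall fun n => ?_)
    (Eventually.of_forall fun n => Eventually.of_forall fun x _ => ?_) hgγ.abs ?_
  · exact (hg.mul_continuousOn (hγ.mul (continuous_cutoff n)).continuousOn).def'.aestronglyMeasurable
  · rw [← mul_assoc, Real.norm_eq_abs, abs_mul]
    exact mul_le_of_le_one_right (abs_nonneg _) (abs_cutoff_le n x)
  · have : ∀ᵐ x : ℝ, x ≠ ℓ := by simp [ae_iff, measure_singleton]
    filter_upwards [this] with x hx hx'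
    rw [uIoc_of_le hℓ] at hx'
    simpa using ((tendsto_cutoff (lt_of_le_of_ne hx'.2 hx)).const_mul (γ x)).const_mul (g x)

/-- The primitive `D t x = ∫₀ˣ r t` satisfies `∂ₜ D = -f`. -/
lemma WeaklyConserved.integral_primitive_mul (hT : 0 < T) (hℓ : 0 < ℓ)
    (hr : ContinuousInL1 T ℓ r) (hf : ContinuousInL1 T ℓ f) (hw : WeaklyConserved T ℓ r f)
    {γ : ℝ → ℝ} (hγ : ContinuousOn γ (Icc 0 ℓ)) {t : ℝ} (ht : t ∈ Icc 0 T) :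
    ∫ x in (0 : ℝ)..ℓ, (∫ y in (0 : ℝ)..x, r t y) * γ x
      = -∫ σ in (0 : ℝ)..t, ∫ x in (0 : ℝ)..ℓ, f σ x * γ x := by
  wlog hγc : Continuous γ generalizing γ
  · have h1 := this (γ := IccExtend hℓ.le ((Icc 0 ℓ).domRestrict γ))
      (continuousOn_iff_continuous_domRestrict.1 hγ).Icc_extend'.continuousOn
      (continuousOn_iff_continuous_domRestrict.1 hγ).Icc_extend'
    have h2 : ∀ x ∈ Icc 0 ℓ, IccExtend hℓ.le ((Icc 0 ℓ).domRestrict γ) x = γ x :=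
      fun x hx => IccExtend_of_mem _ _ hx
    have h3 : ∀ g : ℝ → ℝ, ∫ x in (0 : ℝ)..ℓ, g x * IccExtend hℓ.le ((Icc 0 ℓ).domRestrict γ) x
        = ∫ x in (0 : ℝ)..ℓ, g x * γ x := fun g =>
      intervalIntegral.integral_congr fun x hx => by
        rw [uIcc_of_le hℓ.le] at hx
        simp only [h2 x hx]
    simpa only [h3] using h1
  have hsub : Icc 0 t ⊆ Icc 0 T := Icc_subset_Icc_right ht.2
  have h1 := tendsto_integral_mul_cutoff hℓ.le
    (integrable_of_continuousOn_Icc hℓ.le (continuousOn_primitive hℓ.le (hr t ht).1)) hγc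
  have h2 : Tendsto (fun n => ∫ σ in (0 : ℝ)..t, ∫ x in (0 : ℝ)..ℓ, f σ x * (γ x * cutoff ℓ n x))
      atTop (𝓝 (∫ σ in (0 : ℝ)..t, ∫ x in (0 : ℝ)..ℓ, f σ x * γ x)) := by
    have habs := (hf.mul_const hℓ.le hγ).abs hℓ.le
    refine intervalIntegral.tendsto_integral_filter_of_dominated_convergence
      (fun σ => ∫ x in (0 : ℝ)..ℓ, |f σ x * γ x|) (Eventually.of_forall fun n => ?_)
      (Eventually.of_forall fun n => Eventually.of_forall fun σ hσ => ?_)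
      (integrable_of_continuousOn_Icc ht.1 ((habs.continuousOn_integral hℓ.le).mono hsub)) ?_
    · exact (integrable_of_continuousOn_Icc ht.1 (((hf.mul_const hℓ.le
        (hγc.mul (continuous_cutoff n)).continuousOn).continuousOn_integral
          hℓ.le).mono hsub)).def'.aestronglyMeasurable
    · rw [uIoc_of_le ht.1] at hσ
      have hσ' := hsub (Ioc_subset_Icc_self hσ)
      refine (intervalIntegral.abs_integral_le_integral_abs hℓ.le).trans ?_
      refine intervalIntegral.integral_mono_on hℓ.le ?_ (habs σ hσ').1 fun x _ => ?_
      · exact ((hf σ hσ').1.mul_continuousOn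
          (hγc.mul (continuous_cutoff n)).continuousOn).abs
      · rw [← mul_assoc, abs_mul]
        exact mul_le_of_le_one_right (abs_nonneg _) (abs_cutoff_le n x)
    · refine Eventually.of_forall fun σ hσ => ?_
      rw [uIoc_of_le ht.1] at hσ
      exact tendsto_integral_mul_cutoff hℓ.le (hf σ (hsub (Ioc_subset_Icc_self hσ))).1 hγc
  refine tendsto_nhds_unique h1 (h2.neg.congr fun n => ?_)
  exact (hw.integral_primitive_mul_of_vanishing hT hℓ hr hf (hγc.mul (continuous_cutoff n))
    (sub_lt_self ℓ (show 0 < 1 / ((n : ℝ) + 1) by positivity))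
    (fun x hx => by rw [Pi.mul_apply, cutoff_eq_zero hx, mul_zero]) t ht).symm

end RoadTraffic

namespace RoadTraffic
open Filter Topology

variable {T ℓ : ℝ} {r f : ℝ → ℝ → ℝ}

/-- The energy `∫ D²` of the primitive `D t x = ∫₀ˣ r t`. -/
noncomputable def energy (ℓ : ℝ) (r : ℝ → ℝ → ℝ) (t : ℝ) : ℝ :=
  ∫ x in (0 : ℝ)..ℓ, (∫ y in (0 : ℝ)..x, r t y) ^ 2

lemma energy_nonneg (hℓ : 0 ≤ ℓ) (t : ℝ) : 0 ≤ energy ℓ r t :=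
  intervalIntegral.integral_nonneg hℓ fun _ _ => sq_nonneg _

lemma hasDerivWithinAt_integral_right (hT : 0 ≤ T) {k : ℝ → ℝ} (hk : ContinuousOn k (Icc 0 T))
    {t : ℝ} (ht : t ∈ Icc 0 T) :
    HasDerivWithinAt (fun t' => ∫ s in t..t', k s) (k t) (Icc 0 T) t := by
  have hk' : Continuous (IccExtend hT ((Icc 0 T).domRestrict k)) :=
    (continuousOn_iff_continuous_domRestrict.1 hk).Icc_extend'
  have hke : ∀ s ∈ Icc 0 T, IccExtend hT ((Icc 0 T).domRestrict k) s = k s :=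
    fun s hs => IccExtend_of_mem _ _ hs
  have h := (hasDerivAt_integral_of_continuous hk' t t).hasDerivWithinAt (s := Icc 0 T)
  rw [hke t ht] at h
  have hcongr : ∀ t' ∈ Icc 0 T, ∫ s in t..t', k s
      = ∫ s in t..t', IccExtend hT ((Icc 0 T).domRestrict k) s := fun t' ht' =>
    intervalIntegral.integral_congr fun s hs => (hke s (uIcc_subset_Icc ht ht' hs)).symm
  exact h.congr hcongr (hcongr t ht)

lemma WeaklyConserved.hasDerivWithinAt_energy (hT : 0 < T) (hℓ : 0 < ℓ)
    (hr : ContinuousInL1 T ℓ r) (hf : ContinuousInL1 T ℓ f) (hw : WeaklyConserved T ℓ r f)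
    {t : ℝ} (ht : t ∈ Icc 0 T) :
    HasDerivWithinAt (energy ℓ r)
      (-2 * ∫ x in (0 : ℝ)..ℓ, f t x * ∫ y in (0 : ℝ)..x, r t y) (Icc 0 T) t := by
  set D : ℝ → ℝ → ℝ := fun t x => ∫ y in (0 : ℝ)..x, r t y with hD
  have hDc : ∀ s ∈ Icc 0 T, ContinuousOn (D s) (Icc 0 ℓ) := fun s hs =>
    RoadTraffic.continuousOn_primitive hℓ.le (hr s hs).1
  have hkc : ∀ {γ : ℝ → ℝ}, ContinuousOn γ (Icc 0 ℓ) →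
      ContinuousOn (fun σ => ∫ x in (0 : ℝ)..ℓ, f σ x * γ x) (Icc 0 T) := fun hγ =>
    (hf.mul_const hℓ.le hγ).continuousOn_integral hℓ.le
  have hki : ∀ {γ : ℝ → ℝ}, ContinuousOn γ (Icc 0 ℓ) → ∀ s ∈ Icc 0 T, ∀ s' ∈ Icc 0 T,
      IntervalIntegrable (fun σ => ∫ x in (0 : ℝ)..ℓ, f σ x * γ x) volume s s' :=
    fun hγ s hs s' hs' => IntervalIntegrable.mono_Icc hT.le
      (integrable_of_continuousOn_Icc hT.le (hkc hγ)) hs hs'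
  have hdiff : ∀ {γ : ℝ → ℝ}, ContinuousOn γ (Icc 0 ℓ) → ∀ t' ∈ Icc 0 T,
      ∫ x in (0 : ℝ)..ℓ, (D t' x - D t x) * γ x
        = -∫ σ in t..t', ∫ x in (0 : ℝ)..ℓ, f σ x * γ x := by
    intro γ hγ t' ht'
    have i : ∀ s ∈ Icc 0 T, IntervalIntegrable (fun x => D s x * γ x) volume 0 ℓ := fun s hs =>
      integrable_of_continuousOn_Icc hℓ.le ((hDc s hs).mul hγ)
    simp_rw [sub_mul]
    have h0 : (0 : ℝ) ∈ Icc 0 T := ⟨le_rfl, hT.le⟩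
    rw [intervalIntegral.integral_sub (i t' ht') (i t ht),
      hw.integral_primitive_mul hT hℓ hr hf hγ ht', hw.integral_primitive_mul hT hℓ hr hf hγ ht,
      ← intervalIntegral.integral_add_adjacent_intervals (hki hγ 0 h0 t ht) (hki hγ t ht t' ht')]
    ring
  set R : ℝ → ℝ := fun t' => ∫ σ in t..t', ∫ x in (0 : ℝ)..ℓ, f σ x * (D t' x - D t x) with hR
  have hexp : ∀ t' ∈ Icc 0 T, energy ℓ r t' = energy ℓ r t
      + (-2) * (∫ σ in t..t', ∫ x in (0 : ℝ)..ℓ, f σ x * D t x) - R t' := by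
    intro t' ht'
    have h1 := hdiff (hDc t ht) t' ht'
    have h2 := hdiff ((hDc t' ht').sub (hDc t ht)) t' ht'
    have i1 : IntervalIntegrable (fun x => D t' x ^ 2) volume 0 ℓ :=
      integrable_of_continuousOn_Icc hℓ.le ((hDc t' ht').pow 2)
    have i2 : IntervalIntegrable (fun x => D t x ^ 2) volume 0 ℓ :=
      integrable_of_continuousOn_Icc hℓ.le ((hDc t ht).pow 2)
    have i3 : IntervalIntegrable (fun x => (D t' x - D t x) * D t x) volume 0 ℓ :=
      integrable_of_continuousOn_Icc hℓ.le (((hDc t' ht').sub (hDc t ht)).mul (hDc t ht))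
    have h3 : ∫ x in (0 : ℝ)..ℓ, (D t' x - D t x) * (D t' - D t) x
        = energy ℓ r t' - energy ℓ r t - 2 * ∫ x in (0 : ℝ)..ℓ, (D t' x - D t x) * D t x := by
      rw [energy, energy, ← intervalIntegral.integral_const_mul,
        ← intervalIntegral.integral_sub i1 i2,
        ← intervalIntegral.integral_sub (i1.sub i2) (i3.const_mul 2)]
      refine intervalIntegral.integral_congr fun x _ => ?_
      simp only [Pi.sub_apply, hD]
      ring
    have h4 : R t' = ∫ σ in t..t', ∫ x in (0 : ℝ)..ℓ, f σ x * (D t' - D t) x := rfl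
    rw [h4]
    linarith
  obtain ⟨C, hC⟩ := isCompact_Icc.exists_bound_of_continuousOn
    ((hf.abs hℓ.le).continuousOn_integral hℓ.le)
  have hRbound : ∀ t' ∈ Icc 0 T,
      |R t'| ≤ (C * ∫ x in (0 : ℝ)..ℓ, |r t' x - r t x|) * |t' - t| := by
    intro t' ht'
    rw [← Real.norm_eq_abs]
    refine intervalIntegral.norm_integral_le_of_norm_le_const fun σ hσ => ?_
    have hσ' : σ ∈ Icc 0 T := uIcc_subset_Icc ht ht' (uIoc_subset_uIcc hσ)
    have hγ := (hDc t' ht').sub (hDc t ht)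
    refine (intervalIntegral.abs_integral_le_integral_abs hℓ.le).trans ?_
    have hε : 0 ≤ ∫ x in (0 : ℝ)..ℓ, |r t' x - r t x| :=
      intervalIntegral.integral_nonneg hℓ.le fun _ _ => abs_nonneg _
    calc ∫ x in (0 : ℝ)..ℓ, |f σ x * (D t' x - D t x)|
        ≤ ∫ x in (0 : ℝ)..ℓ, |f σ x| * ∫ x in (0 : ℝ)..ℓ, |r t' x - r t x| := by
          refine intervalIntegral.integral_mono_on hℓ.le ((hf.mul_const hℓ.le hγ) σ hσ').1.abs
            ((hf σ hσ').1.abs.mul_const _) fun x hx => ?_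
          rw [abs_mul]
          gcongr
          exact hr.abs_primitive_sub_le hℓ.le ht ht' hx
      _ ≤ _ := by
          rw [intervalIntegral.integral_mul_const]
          gcongr
          exact (le_abs_self _).trans (hC σ hσ')
  have hR0 : R t = 0 := intervalIntegral.integral_same
  have hRd : HasDerivWithinAt R 0 (Icc 0 T) t := by
    rw [hasDerivWithinAt_iff_isLittleO, Asymptotics.isLittleO_iff]
    intro ε hε
    have hlim : Tendsto (fun t' => C * ∫ x in (0 : ℝ)..ℓ, |r t' x - r t x|)
        (𝓝[Icc 0 T] t) (𝓝 0) := by simpa using (hr t ht).2.const_mul C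
    filter_upwards [hlim.eventually_le_const hε, self_mem_nhdsWithin] with t' h1 h2
    rw [hR0, smul_zero, sub_zero, sub_zero]
    exact (hRbound t' h2).trans (by rw [Real.norm_eq_abs]; gcongr)
  have h1 := (((hasDerivWithinAt_integral_right hT.le (hkc (hDc t ht)) ht).const_mul
    (-2)).const_add (energy ℓ r t)).sub hRd
  rw [sub_zero] at h1
  exact h1.congr hexp (hexp t ht)

/-- A nonnegative function with `E' ≤ K E` and `E 0 = 0` vanishes. -/
lemma eq_zero_of_deriv_le {E E' : ℝ → ℝ} {K : ℝ} (h0 : E 0 = 0) (hE : ∀ t ∈ Icc 0 T, 0 ≤ E t)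
    (hd : ∀ t ∈ Icc 0 T, HasDerivWithinAt E (E' t) (Icc 0 T) t)
    (hle : ∀ t ∈ Icc 0 T, E' t ≤ K * E t) {t : ℝ} (ht : t ∈ Icc 0 T) : E t = 0 := by
  have hT : 0 ≤ T := ht.1.trans ht.2
  have hd' : ∀ t ∈ Icc 0 T, HasDerivWithinAt (fun t => E t * Real.exp (-K * t))
      (E' t * Real.exp (-K * t) + E t * (Real.exp (-K * t) * (-K * 1))) (Icc 0 T) t := fun t ht =>
    (hd t ht).mul (((hasDerivAt_id t).const_mul (-K)).exp.hasDerivWithinAt)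
  have hanti : AntitoneOn (fun t => E t * Real.exp (-K * t)) (Icc 0 T) := by
    refine antitoneOn_of_hasDerivWithinAt_nonpos (convex_Icc 0 T)
      (fun t ht => (hd' t ht).continuousWithinAt)
      (fun t ht => (hd' t (interior_subset ht)).mono interior_subset) fun t ht => ?_
    have := hle t (interior_subset ht)
    have hexp := Real.exp_pos (-K * t)
    nlinarith
  have h1 := hanti ⟨le_rfl, hT⟩ ht ht.1
  simp only [h0, zero_mul] at h1
  exact le_antisymm (nonpos_of_mul_nonpos_left h1 (Real.exp_pos _)) (hE t ht)

lemma primitive_eq_zero_of_energy (hℓ : 0 < ℓ) (hr : ContinuousInL1 T ℓ r) {t : ℝ}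
    (ht : t ∈ Icc 0 T) (h : energy ℓ r t = 0) {x : ℝ} (hx : x ∈ Icc 0 ℓ) :
    ∫ y in (0 : ℝ)..x, r t y = 0 := by
  by_contra hne
  refine absurd h (ne_of_gt (intervalIntegral.integral_pos hℓ
    ((RoadTraffic.continuousOn_primitive hℓ.le (hr t ht).1).pow 2)
    (fun _ _ => sq_nonneg _) ⟨x, hx, sq_pos_of_ne_zero hne⟩))

lemma ae_eq_zero_of_primitive_eq_zero (hℓ : 0 < ℓ) {g : ℝ → ℝ}
    (hg : IntervalIntegrable g volume 0 ℓ) (h : ∀ x ∈ Icc 0 ℓ, ∫ y in (0 : ℝ)..x, g y = 0) :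
    ∀ᵐ x ∂(volume.restrict (Icc (0 : ℝ) ℓ)), g x = 0 := by
  rw [← restrict_Ioo_eq_restrict_Icc, ae_restrict_iff' measurableSet_Ioo]
  filter_upwards [ae_deriv_primitive_eq hg] with x hx hx'
  rw [uIoc_of_le hℓ.le] at hx
  have h1 := hx (Ioo_subset_Ioc_self hx')
  have h2 : (fun x => ∫ y in (0 : ℝ)..x, g y) =ᶠ[𝓝 x] fun _ => 0 := by
    filter_upwards [Ioo_mem_nhds hx'.1 hx'.2] with y hy using h y (Ioo_subset_Icc_self hy)
  exact (h1.congr_of_eventuallyEq h2.symm).unique (hasDerivAt_const x 0)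

/-- Energy method: conservation plus a Gronwall bound on the dissipation force `r` to vanish. -/
lemma WeaklyConserved.ae_eq_zero (hT : 0 < T) (hℓ : 0 < ℓ)
    (hr : ContinuousInL1 T ℓ r) (hf : ContinuousInL1 T ℓ f) (hw : WeaklyConserved T ℓ r f) {K : ℝ}
    (hK : ∀ t ∈ Icc 0 T,
      -2 * (∫ x in (0 : ℝ)..ℓ, f t x * ∫ y in (0 : ℝ)..x, r t y) ≤ K * energy ℓ r t) :
    ∀ t ∈ Icc 0 T, ∀ᵐ x ∂(volume.restrict (Icc (0 : ℝ) ℓ)), r t x = 0 := by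
  intro t ht
  have h0 : (0 : ℝ) ∈ Icc 0 T := ⟨le_rfl, hT.le⟩
  have hE0 : energy ℓ r 0 = 0 := by
    have := hw.integral_primitive_mul hT hℓ hr hf
      (RoadTraffic.continuousOn_primitive hℓ.le (hr 0 h0).1) h0
    rw [intervalIntegral.integral_same, neg_zero] at this
    simpa only [energy, sq] using this
  have hE := eq_zero_of_deriv_le hE0 (fun t _ => energy_nonneg hℓ.le t)
    (fun t ht => hw.hasDerivWithinAt_energy hT hℓ hr hf ht) hK ht
  exact ae_eq_zero_of_primitive_eq_zero hℓ (hr t ht).1 fun x hx =>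
    primitive_eq_zero_of_energy hℓ hr ht hE hx

end RoadTraffic

namespace RoadTraffic
open Filter Topology NNReal

variable {T ℓ : ℝ}

/-- `-∂ₓ(c D²)` integrated over the road, for the primitive `D` of `g`. -/
lemma neg_two_mul_integral_flux_le (hℓ : 0 < ℓ) {g c : ℝ → ℝ}
    (hg : IntervalIntegrable g volume 0 ℓ) {K : ℝ≥0} (hc : LipschitzOnWith K c (Icc 0 ℓ)) :
    -2 * (∫ x in (0 : ℝ)..ℓ, c x * g x * ∫ y in (0 : ℝ)..x, g y)
      ≤ -(c ℓ * (∫ y in (0 : ℝ)..ℓ, g y) ^ 2)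
        + K * ∫ x in (0 : ℝ)..ℓ, (∫ y in (0 : ℝ)..x, g y) ^ 2 := by
  set D : ℝ → ℝ := fun x => ∫ y in (0 : ℝ)..x, g y with hD
  have hDac : AbsolutelyContinuousOnInterval D 0 ℓ := absolutelyContinuousOnInterval_primitive hg
  have hcac : AbsolutelyContinuousOnInterval c 0 ℓ :=
    LipschitzOnWith.absolutelyContinuousOnInterval (by rwa [uIcc_of_le hℓ.le])
  have hD2 : AbsolutelyContinuousOnInterval (D * D) 0 ℓ := hDac.mul hDac
  have hD0 : D 0 = 0 := intervalIntegral.integral_same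
  have h := hcac.integral_mul_deriv_eq_deriv_mul hD2
  have h1 : ∫ x in (0 : ℝ)..ℓ, c x * deriv (D * D) x
      = 2 * ∫ x in (0 : ℝ)..ℓ, c x * g x * D x := by
    rw [← intervalIntegral.integral_const_mul]
    refine intervalIntegral.integral_congr_ae ?_
    filter_upwards [ae_deriv_primitive_eq hg] with x hx hx'
    rw [((hx hx').mul (hx hx')).deriv]
    ring
  have hDc : ContinuousOn D (Icc 0 ℓ) := continuousOn_primitive hℓ.le hg
  have h2 : ∫ x in (0 : ℝ)..ℓ, deriv c x * (D * D) x ≤ ∫ x in (0 : ℝ)..ℓ, K * D x ^ 2 := by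
    refine intervalIntegral.integral_mono_on_of_le_Ioo hℓ.le
      (hcac.intervalIntegrable_deriv.mul_continuousOn hD2.continuousOn)
      (integrable_of_continuousOn_Icc hℓ.le (continuousOn_const.mul (hDc.pow 2))) fun x hx => ?_
    have h3 : deriv c x ≤ K :=
      (le_abs_self _).trans (norm_deriv_le_of_lipschitzOn (Icc_mem_nhds hx.1 hx.2) hc)
    rw [Pi.mul_apply, ← sq]
    gcongr
  rw [intervalIntegral.integral_const_mul] at h2
  simp only [Pi.mul_apply, hD0, mul_zero, sub_zero] at h h2
  rw [h1] at h
  nlinarith [h, h2]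

/-- The weak form of `SatisfiesWeakly` for representatives. -/
def WeakForm (T ℓ : ℝ) (c : ℝ → ℝ → ℝ) (r₀ u : ℝ → ℝ) (r : ℝ → ℝ → ℝ) : Prop :=
  ∀ φ : ℝ × ℝ → ℝ, IsTestFunction T ℓ φ →
    (∫ t in (0 : ℝ)..T, ∫ x in (0 : ℝ)..ℓ,
        r t x * (fderiv ℝ φ (t, x) (1, 0) + c t x * fderiv ℝ φ (t, x) (0, 1)))
      + (∫ x in (0 : ℝ)..ℓ, r₀ x * φ (0, x))
      + (∫ t in (0 : ℝ)..T, u t * φ (t, 0)) = 0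

variable {r₁ r₂ c₁ c₂ : ℝ → ℝ → ℝ} {r₀ u : ℝ → ℝ}

lemma WeakForm.weaklyConserved_sub (hT : 0 < T) (hℓ : 0 < ℓ)
    (hr₁ : ContinuousInL1 T ℓ r₁) (hr₂ : ContinuousInL1 T ℓ r₂)
    (hc₁ : ContinuousOn (fun z : ℝ × ℝ => c₁ z.1 z.2) (Icc 0 T ×ˢ Icc 0 ℓ))
    (hc₂ : ContinuousOn (fun z : ℝ × ℝ => c₂ z.1 z.2) (Icc 0 T ×ˢ Icc 0 ℓ))
    (h₁ : WeakForm T ℓ c₁ r₀ u r₁) (h₂ : WeakForm T ℓ c₂ r₀ u r₂) :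
    WeaklyConserved T ℓ (fun t x => r₁ t x - r₂ t x)
      (fun t x => c₁ t x * r₁ t x - c₂ t x * r₂ t x) := by
  intro φ hφ
  have hd : Continuous (fderiv ℝ φ) := hφ.1.continuous_fderiv one_ne_zero
  have hcont : ∀ {c : ℝ → ℝ → ℝ}, ContinuousOn (fun z : ℝ × ℝ => c z.1 z.2) (Icc 0 T ×ˢ Icc 0 ℓ) →
      ContinuousOn (fun z : ℝ × ℝ => (fun t x => fderiv ℝ φ (t, x) (1, 0)
        + c t x * fderiv ℝ φ (t, x) (0, 1)) z.1 z.2) (Icc 0 T ×ˢ Icc 0 ℓ) := fun hc =>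
    ((hd.clm_apply continuous_const).continuousOn).add
      (hc.mul (hd.clm_apply continuous_const).continuousOn)
  have i₁ := hr₁.mul_left (c := fun t x => fderiv ℝ φ (t, x) (1, 0)
    + c₁ t x * fderiv ℝ φ (t, x) (0, 1)) hℓ.le (hcont hc₁)
  have i₂ := hr₂.mul_left (c := fun t x => fderiv ℝ φ (t, x) (1, 0)
    + c₂ t x * fderiv ℝ φ (t, x) (0, 1)) hℓ.le (hcont hc₂)
  have e₁ := h₁ φ hφ
  have e₂ := h₂ φ hφ
  simp_rw [mul_comm (r₁ _ _)] at e₁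
  simp_rw [mul_comm (r₂ _ _)] at e₂
  refine Eq.trans ?_ (sub_eq_zero.2 (e₁.trans e₂.symm))
  rw [add_sub_add_right_eq_sub, add_sub_add_right_eq_sub,
    ← intervalIntegral.integral_sub
      (integrable_of_continuousOn_Icc hT.le (i₁.continuousOn_integral hℓ.le))
      (integrable_of_continuousOn_Icc hT.le (i₂.continuousOn_integral hℓ.le))]
  refine intervalIntegral.integral_congr fun t ht => ?_
  rw [uIcc_of_le hT.le] at ht
  simp only
  rw [← intervalIntegral.integral_sub (i₁ t ht).1 (i₂ t ht).1]
  refine intervalIntegral.integral_congr fun x _ => ?_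
  simp only
  ring

/-- Uniqueness: two weak solutions with the same data whose speeds differ by at most a multiple of
the difference of the total masses coincide, if one of them is bounded. -/
theorem WeakForm.ae_eq (hT : 0 < T) (hℓ : 0 < ℓ)
    (hr₁ : ContinuousInL1 T ℓ r₁) (hr₂ : ContinuousInL1 T ℓ r₂)
    (hc₁ : ContinuousOn (fun z : ℝ × ℝ => c₁ z.1 z.2) (Icc 0 T ×ˢ Icc 0 ℓ))
    (hc₂ : ContinuousOn (fun z : ℝ × ℝ => c₂ z.1 z.2) (Icc 0 T ×ˢ Icc 0 ℓ))
    (h₁ : WeakForm T ℓ c₁ r₀ u r₁) (h₂ : WeakForm T ℓ c₂ r₀ u r₂)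
    {K : ℝ≥0} (hlip : ∀ t ∈ Icc 0 T, LipschitzOnWith K (c₁ t) (Icc 0 ℓ))
    {cmin : ℝ} (hcmin : 0 < cmin) (hmin : ∀ t ∈ Icc 0 T, cmin ≤ c₁ t ℓ)
    {M : ℝ} (hM : ∀ t ∈ Icc 0 T, ∀ᵐ x ∂(volume.restrict (Icc (0 : ℝ) ℓ)), |r₂ t x| ≤ M)
    {K' : ℝ} (hdiff : ∀ t ∈ Icc 0 T, ∀ x ∈ Icc 0 ℓ,
      |c₁ t x - c₂ t x| ≤ K' * |∫ y in (0 : ℝ)..ℓ, (r₁ t y - r₂ t y)|) :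
    ∀ t ∈ Icc 0 T, ∀ᵐ x ∂(volume.restrict (Icc (0 : ℝ) ℓ)), r₁ t x = r₂ t x := by
  have hr := hr₁.sub hℓ.le hr₂
  have hf := (hr₁.mul_left hℓ.le hc₁).sub hℓ.le (hr₂.mul_left hℓ.le hc₂)
  have hw := WeakForm.weaklyConserved_sub hT hℓ hr₁ hr₂ hc₁ hc₂ h₁ h₂
  have key := hw.ae_eq_zero hT hℓ hr hf (K := K + ℓ * (K' * M) ^ 2 / cmin) fun t ht => by
    set D : ℝ → ℝ := fun x => ∫ y in (0 : ℝ)..x, (r₁ t y - r₂ t y) with hD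
    have hDc : ContinuousOn D (Icc 0 ℓ) := continuousOn_primitive hℓ.le (hr t ht).1
    have hg : IntervalIntegrable (fun x => (c₁ t x - c₂ t x) * r₂ t x) volume 0 ℓ :=
      intervalIntegrable_continuousOn_mul hℓ.le
        ((continuousOn_section hc₁ ht).sub (continuousOn_section hc₂ ht)) (hr₂ t ht).1
    have hDu : ContinuousOn D (uIcc 0 ℓ) := by rwa [uIcc_of_le hℓ.le]
    have i1 : IntervalIntegrable (fun x => c₁ t x * (r₁ t x - r₂ t x) * D x) volume 0 ℓ :=
      (intervalIntegrable_continuousOn_mul hℓ.le (continuousOn_section hc₁ ht)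
        (hr t ht).1).mul_continuousOn hDu
    have i2 : IntervalIntegrable (fun x => (c₁ t x - c₂ t x) * r₂ t x * D x) volume 0 ℓ :=
      hg.mul_continuousOn hDu
    have e1 : ∫ x in (0 : ℝ)..ℓ, (c₁ t x * r₁ t x - c₂ t x * r₂ t x) * D x
        = (∫ x in (0 : ℝ)..ℓ, c₁ t x * (r₁ t x - r₂ t x) * D x)
          + ∫ x in (0 : ℝ)..ℓ, (c₁ t x - c₂ t x) * r₂ t x * D x := by
      rw [← intervalIntegral.integral_add i1 i2]
      refine intervalIntegral.integral_congr fun x _ => ?_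
      ring
    have e2 : -2 * (∫ x in (0 : ℝ)..ℓ, c₁ t x * (r₁ t x - r₂ t x) * D x)
        ≤ -(c₁ t ℓ * D ℓ ^ 2) + K * ∫ x in (0 : ℝ)..ℓ, D x ^ 2 :=
      neg_two_mul_integral_flux_le hℓ (hr t ht).1 (hlip t ht)
    have e3 : ∫ x in (0 : ℝ)..ℓ, -2 * ((c₁ t x - c₂ t x) * r₂ t x * D x)
        ≤ ∫ x in (0 : ℝ)..ℓ, (cmin / ℓ * D ℓ ^ 2 + ℓ * (K' * M) ^ 2 / cmin * D x ^ 2) := by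
      refine intervalIntegral.integral_mono_ae_restrict hℓ.le (i2.const_mul _)
        (integrable_of_continuousOn_Icc hℓ.le (by fun_prop)) ?_
      filter_upwards [hM t ht, ae_restrict_mem measurableSet_Icc] with x hx hx'
      have h3 : |(c₁ t x - c₂ t x) * r₂ t x * D x| ≤ K' * |D ℓ| * M * |D x| := by
        rw [abs_mul, abs_mul]
        gcongr
        · exact (abs_nonneg _).trans (hdiff t ht x hx')
        · exact hdiff t ht x hx'
      have h4 : 0 ≤ (cmin / ℓ) * (|D ℓ| - ℓ * (K' * M) / cmin * |D x|) ^ 2 := by positivity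
      have h5 : (cmin / ℓ) * (|D ℓ| - ℓ * (K' * M) / cmin * |D x|) ^ 2
          = cmin / ℓ * D ℓ ^ 2 + ℓ * (K' * M) ^ 2 / cmin * D x ^ 2
            - 2 * (K' * |D ℓ| * M * |D x|) := by
        rw [← sq_abs (D ℓ), ← sq_abs (D x)]
        field_simp
        ring
      have h6 := neg_abs_le ((c₁ t x - c₂ t x) * r₂ t x * D x)
      linarith
    rw [intervalIntegral.integral_const_mul, intervalIntegral.integral_add
      (integrable_of_continuousOn_Icc hℓ.le (by fun_prop))
      (integrable_of_continuousOn_Icc hℓ.le (by fun_prop)),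
      intervalIntegral.integral_const, intervalIntegral.integral_const_mul, sub_zero,
      smul_eq_mul] at e3
    have e4 : ℓ * (cmin / ℓ * D ℓ ^ 2) = cmin * D ℓ ^ 2 := by field_simp
    have e5 : cmin * D ℓ ^ 2 ≤ c₁ t ℓ * D ℓ ^ 2 := by gcongr; exact hmin t ht
    change -2 * (∫ x in (0 : ℝ)..ℓ, (c₁ t x * r₁ t x - c₂ t x * r₂ t x) * D x)
      ≤ _ * ∫ x in (0 : ℝ)..ℓ, D x ^ 2
    rw [e1, add_mul]
    linarith
  intro t ht
  filter_upwards [key t ht] with x hx using sub_eq_zero.1 hx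

end RoadTraffic

namespace RoadTraffic
open Filter Topology NNReal

/-- `Z` is an increasing bijection of the line with inverse `W`, both `K`-Lipschitz. -/
structure IncreasingBiLipschitz (K : ℝ≥0) (Z W : ℝ → ℝ) : Prop where
  strictMono : StrictMono Z
  lipschitz : LipschitzWith K Z
  lipschitz_inv : LipschitzWith K W
  left_inv : ∀ x, W (Z x) = x
  right_inv : ∀ x, Z (W x) = x

namespace IncreasingBiLipschitz

variable {K : ℝ≥0} {Z W : ℝ → ℝ}

lemma symm (h : IncreasingBiLipschitz K Z W) : IncreasingBiLipschitz K W Z where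
  strictMono x y hxy := by
    rw [← h.right_inv x, ← h.right_inv y] at hxy
    exact h.strictMono.lt_iff_lt.1 hxy
  lipschitz := h.lipschitz_inv
  lipschitz_inv := h.lipschitz
  left_inv := h.right_inv
  right_inv := h.left_inv

lemma measure_image_eq_zero (h : IncreasingBiLipschitz K Z W) {N : Set ℝ} (hN : volume N = 0) :
    volume (Z '' N) = 0 := by
  have h1 := h.lipschitz.hausdorffMeasure_image_le zero_le_one N
  rw [hausdorffMeasure_real, hN, mul_zero] at h1
  exact le_antisymm h1 zero_le

lemma ae_comp (h : IncreasingBiLipschitz K Z W) {P : ℝ → Prop} (hP : ∀ᵐ x, P x) :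
    ∀ᵐ x, P (Z x) := by
  rw [ae_iff] at hP ⊢
  have := h.symm.measure_image_eq_zero hP
  refine measure_mono_null (fun x hx => ?_) this
  exact ⟨Z x, hx, h.left_inv x⟩

lemma deriv_nonneg (h : IncreasingBiLipschitz K Z W) (x : ℝ) : 0 ≤ deriv Z x :=
  h.strictMono.monotone.deriv_nonneg

lemma abs_deriv_le (h : IncreasingBiLipschitz K Z W) (x : ℝ) : |deriv Z x| ≤ K :=
  norm_deriv_le_of_lipschitz h.lipschitz

lemma deriv_le (h : IncreasingBiLipschitz K Z W) (x : ℝ) : deriv Z x ≤ K :=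
  (le_abs_self _).trans (h.abs_deriv_le x)

lemma image_Ioc (h : IncreasingBiLipschitz K Z W) (a b : ℝ) :
    Z '' Ioc a b = Ioc (Z a) (Z b) := by
  ext y
  constructor
  · rintro ⟨x, hx, rfl⟩
    exact ⟨h.strictMono hx.1, h.strictMono.monotone hx.2⟩
  · intro hy
    refine ⟨W y, ⟨?_, ?_⟩, h.right_inv y⟩
    · rw [← h.left_inv a]; exact h.symm.strictMono hy.1
    · rw [← h.left_inv b]; exact h.symm.strictMono.monotone hy.2

/-- Change of variables for increasing bi-Lipschitz maps. -/
lemma integral_comp_mul_deriv (h : IncreasingBiLipschitz K Z W) (g : ℝ → ℝ) (a b : ℝ) :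
    ∫ x in a..b, g (Z x) * deriv Z x = ∫ y in Z a..Z b, g y := by
  wlog hab : a ≤ b generalizing a b
  · rw [intervalIntegral.integral_symm, this b a (not_le.1 hab).le,
      intervalIntegral.integral_symm, neg_neg]
  rw [intervalIntegral.integral_of_le hab,
    intervalIntegral.integral_of_le (h.strictMono.monotone hab), ← h.image_Ioc]
  set S : Set ℝ := Ioc a b ∩ {x | DifferentiableAt ℝ Z x} with hS
  have hSm : MeasurableSet S := measurableSet_Ioc.inter (measurableSet_of_differentiableAt ℝ Z)
  have hae : ∀ᵐ x, DifferentiableAt ℝ Z x := h.lipschitz.ae_differentiableAt_real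
  have hSae : S =ᵐ[volume] Ioc a b := by
    filter_upwards [hae] with x hx
    exact propext ⟨fun hx' => hx'.1, fun hx' => ⟨hx', hx⟩⟩
  have himg : Z '' S =ᵐ[volume] Z '' Ioc a b := by
    have h1 : ∀ᵐ y, DifferentiableAt ℝ Z (W y) := h.symm.ae_comp hae
    filter_upwards [h1] with y hy
    refine propext ⟨fun ⟨x, hx, hxy⟩ => ⟨x, hx.1, hxy⟩, fun ⟨x, hx, hxy⟩ => ⟨x, ⟨hx, ?_⟩, hxy⟩⟩
    rwa [← hxy, h.left_inv] at hy
  rw [← setIntegral_congr_set hSae, ← setIntegral_congr_set himg,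
    integral_image_eq_integral_deriv_smul_of_monotoneOn hSm
      (fun x hx => hx.2.hasDerivAt.hasDerivWithinAt) (h.strictMono.monotone.monotoneOn S)]
  simp_rw [smul_eq_mul, mul_comm]

lemma measurable_deriv_mul_comp (h : IncreasingBiLipschitz K Z W) {g : ℝ → ℝ} (hg : Measurable g) :
    Measurable fun x => g (Z x) * deriv Z x :=
  (hg.comp h.lipschitz.continuous.measurable).mul (measurable_deriv Z)

lemma abs_comp_mul_deriv_le (h : IncreasingBiLipschitz K Z W) {g : ℝ → ℝ} {M : ℝ}
    (hg : ∀ x, |g x| ≤ M) (x : ℝ) : |g (Z x) * deriv Z x| ≤ M * K := by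
  rw [abs_mul]
  exact mul_le_mul (hg _) (h.abs_deriv_le x) (abs_nonneg _) ((abs_nonneg _).trans (hg 0))

end IncreasingBiLipschitz

lemma intervalIntegrable_of_measurable_of_bound {g : ℝ → ℝ} (hg : Measurable g) {M : ℝ}
    (hM : ∀ x, |g x| ≤ M) (a b : ℝ) : IntervalIntegrable g volume a b :=
  (intervalIntegrable_const (c := M)).mono_fun' hg.aestronglyMeasurable
    (Eventually.of_forall hM)

/-- Pulling back by maps that tend to the identity converges in `L¹`. -/
lemma tendsto_integral_abs_pullback_sub {ι : Type*} {F : Filter ι} {ℓ : ℝ} (hℓ : 0 ≤ ℓ)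
    {K : ι → ℝ≥0} {Z W : ι → ℝ → ℝ} (h : ∀ i, IncreasingBiLipschitz (K i) (Z i) (W i))
    (hK : Tendsto (fun i => (K i : ℝ)) F (𝓝 1)) {η : ι → ℝ} (hη : Tendsto η F (𝓝 0))
    (hZ : ∀ i y, |Z i y - y| ≤ η i) {f : ℝ → ℝ} (hf : Integrable f) (hfm : Measurable f) {M : ℝ}
    (hM : ∀ x, |f x| ≤ M) :
    Tendsto (fun i => ∫ y in (0 : ℝ)..ℓ, |f (Z i y) * deriv (Z i) y - f y|) F (𝓝 0) := by
  have key : ∀ ε > 0, ∀ᶠ i in F,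
      ∫ y in (0 : ℝ)..ℓ, |f (Z i y) * deriv (Z i) y - f y| ≤ (3 + 2 * ℓ) * ε := by
    intro ε hε
    obtain ⟨g, hgc, hfg, hgcont, hgi⟩ := hf.exists_hasCompactSupport_integral_sub_le hε
    obtain ⟨H, hH⟩ := hgcont.bounded_above_of_compact_support hgc
    have hH0 : 0 ≤ H := (norm_nonneg _).trans (hH 0)
    obtain ⟨δ, hδ, hgδ⟩ := Metric.uniformContinuous_iff.1
      (hgc.uniformContinuous_of_continuous hgcont) ε hε
    have hlim : Tendsto (fun i => H * (2 * |(K i : ℝ) - 1| * ℓ + 2 * η i)) F (𝓝 0) := by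
      have h1 : Tendsto (fun i => |(K i : ℝ) - 1|) F (𝓝 0) := by
        simpa using (hK.sub_const 1).abs
      simpa using ((((h1.const_mul 2).mul_const ℓ).add (hη.const_mul 2)).const_mul H)
    filter_upwards [hη.eventually_lt_const hδ, hK.eventually_le_const one_lt_two,
      hlim.eventually_le_const hε] with i h1 h2 h3
    have iabs : ∀ u : ℝ → ℝ, Measurable u → ∀ M, (∀ x, |u x| ≤ M) → ∀ a b,
        IntervalIntegrable (fun x => |u x|) volume a b := fun u hu M hM a b =>
      (intervalIntegrable_of_measurable_of_bound hu hM a b).abs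
    have hd := measurable_deriv (Z i)
    have hfg' : ∀ x, |f x - g x| ≤ M + H := fun x =>
      (abs_sub _ _).trans (add_le_add (hM x) (hH x))
    have i0 : IntervalIntegrable (fun y => |f (Z i y) * deriv (Z i) y - f y|) volume 0 ℓ :=
      iabs _ (((h i).measurable_deriv_mul_comp hfm).sub hfm) (M * K i + M) (fun x =>
        (abs_sub _ _).trans (add_le_add ((h i).abs_comp_mul_deriv_le hM x) (hM x))) _ _
    have i1 : IntervalIntegrable (fun y => |f (Z i y) - g (Z i y)| * deriv (Z i) y) volume 0 ℓ :=
      intervalIntegrable_of_measurable_of_bound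
        ((h i).measurable_deriv_mul_comp (g := fun y => |f y - g y|)
          (hfm.sub hgcont.measurable).abs) ((h i).abs_comp_mul_deriv_le
          (g := fun y => |f y - g y|) fun x => by rw [abs_abs]; exact hfg' x) _ _
    have ider : IntervalIntegrable (deriv (Z i)) volume 0 ℓ :=
      intervalIntegrable_of_measurable_of_bound hd (h i).abs_deriv_le _ _
    have i4 : IntervalIntegrable (fun y => |f y - g y|) volume 0 ℓ :=
      iabs _ (hfm.sub hgcont.measurable) _ hfg' _ _
    have ipt : ∀ y, |f (Z i y) * deriv (Z i) y - f y| ≤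
        |f (Z i y) - g (Z i y)| * deriv (Z i) y + (2 * ε + (H * (|(K i : ℝ) - 1| + K i
          - deriv (Z i) y) + |f y - g y|)) := by
      intro y
      have hd0 := (h i).deriv_nonneg y
      have hdK := (h i).deriv_le y
      have e : f (Z i y) * deriv (Z i) y - f y = (f (Z i y) - g (Z i y)) * deriv (Z i) y
          + ((g (Z i y) - g y) * deriv (Z i) y + (g y * (deriv (Z i) y - 1) + -(f y - g y))) := by
        ring
      rw [e]
      refine (abs_add_le _ _).trans (add_le_add ?_ ((abs_add_le _ _).trans (add_le_add ?_
        ((abs_add_le _ _).trans (add_le_add ?_ ?_)))))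
      · rw [abs_mul, abs_of_nonneg hd0]
      · rw [abs_mul, abs_of_nonneg hd0, mul_comm]
        have h5 : |g (Z i y) - g y| ≤ ε := (hgδ ((hZ i y).trans_lt h1)).le
        exact mul_le_mul (hdK.trans h2) h5 (abs_nonneg _) zero_le_two
      · rw [abs_mul]
        refine mul_le_mul (hH y) ?_ (abs_nonneg _) hH0
        have h6 : |deriv (Z i) y - 1| ≤ |(K i : ℝ) - 1| + |deriv (Z i) y - K i| := by
          rw [show deriv (Z i) y - 1 = ((K i : ℝ) - 1) + (deriv (Z i) y - K i) by ring]
          exact abs_add_le _ _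
        rw [abs_of_nonpos (sub_nonpos.2 hdK)] at h6
        linarith
      · rw [abs_neg]
    have hmono := intervalIntegral.integral_mono hℓ i0
      (i1.add ((intervalIntegrable_const (c := 2 * ε)).add
        ((((intervalIntegrable_const (c := |(K i : ℝ) - 1| + K i)).sub ider).const_mul H).add i4)))
      ipt
    have j2 := (intervalIntegrable_const (μ := volume) (a := 0) (b := ℓ)
      (c := |(K i : ℝ) - 1| + K i)).sub ider
    rw [intervalIntegral.integral_add i1 ((intervalIntegrable_const (c := 2 * ε)).add
        ((j2.const_mul H).add i4)),
      intervalIntegral.integral_add intervalIntegrable_const ((j2.const_mul H).add i4),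
      intervalIntegral.integral_add (j2.const_mul H) i4, intervalIntegral.integral_const_mul H,
      intervalIntegral.integral_sub intervalIntegrable_const ider] at hmono
    have e1 := (h i).integral_comp_mul_deriv (fun y => |f y - g y|) 0 ℓ
    have e2 := (h i).integral_comp_mul_deriv (fun _ => 1) 0 ℓ
    have hle : ∀ a b : ℝ, a ≤ b → ∫ y in a..b, |f y - g y| ≤ ε := fun a b hab => by
      rw [intervalIntegral.integral_of_le hab]
      exact (setIntegral_le_integral (hf.sub hgi).abs
        (Eventually.of_forall fun _ => abs_nonneg _)).trans hfg
    have e3 := hle _ _ ((h i).strictMono.monotone hℓ)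
    have e4 := hle 0 ℓ hℓ
    simp only [one_mul, intervalIntegral.integral_const, smul_eq_mul, mul_one, sub_zero] at e2 hmono
    rw [e1, e2] at hmono
    have hη0 := (abs_le.1 (hZ i 0))
    have hηℓ := (abs_le.1 (hZ i ℓ))
    have e5 : H * (ℓ * (|(K i : ℝ) - 1| + K i) - (Z i ℓ - Z i 0))
        ≤ H * (2 * |(K i : ℝ) - 1| * ℓ + 2 * η i) := by
      gcongr
      have := mul_le_mul_of_nonneg_left (le_abs_self ((K i : ℝ) - 1)) hℓ
      linarith
    linarith
  rw [Metric.tendsto_nhds]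
  intro ε hε
  filter_upwards [key (ε / (2 * (3 + 2 * ℓ))) (by positivity)] with i hi
  have h0 : 0 ≤ ∫ y in (0 : ℝ)..ℓ, |f (Z i y) * deriv (Z i) y - f y| :=
    intervalIntegral.integral_nonneg hℓ fun _ _ => abs_nonneg _
  rw [Real.dist_eq, sub_zero, abs_of_nonneg h0]
  have : (3 + 2 * ℓ) * (ε / (2 * (3 + 2 * ℓ))) = ε / 2 := by field_simp
  linarith

end RoadTraffic

namespace RoadTraffic
open Filter Topology NNReal

/-- A globally defined speed, between two positive constants and Lipschitz in space. -/
structure IsSpeed (c : ℝ → ℝ → ℝ) (L : ℝ≥0) (cmin cmax : ℝ) : Prop where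
  continuous : Continuous fun z : ℝ × ℝ => c z.1 z.2
  lipschitz : ∀ t, LipschitzWith L (c t)
  pos : 0 < cmin
  le : ∀ t x, cmin ≤ c t x
  ge : ∀ t x, c t x ≤ cmax

/-- `Z s t y` is the position at time `s` of the characteristic that is at `y` at time `t`. -/
structure IsFlow (c : ℝ → ℝ → ℝ) (Z : ℝ → ℝ → ℝ → ℝ) : Prop where
  self : ∀ t y, Z t t y = y
  hasDerivAt : ∀ s t y, HasDerivAt (fun s => Z s t y) (c s (Z s t y)) s

variable {c : ℝ → ℝ → ℝ} {L : ℝ≥0} {cmin cmax : ℝ}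

namespace IsSpeed

lemma cmax_pos (h : IsSpeed c L cmin cmax) : 0 < cmax :=
  h.pos.trans_le ((h.le 0 0).trans (h.ge 0 0))

lemma abs_le (h : IsSpeed c L cmin cmax) (t x : ℝ) : |c t x| ≤ cmax := by
  rw [abs_of_nonneg (h.pos.le.trans (h.le t x))]
  exact h.ge t x

lemma exists_trajectory_Ioo (h : IsSpeed c L cmin cmax) (t y : ℝ) {N : ℝ} (hN : |t| < N) :
    ∃ γ : ℝ → ℝ, γ t = y ∧ ∀ s ∈ Ioo (-N) N, HasDerivAt γ (c s (γ s)) s := by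
  have ht := abs_lt.1 hN
  have hN0 : 0 ≤ N := (abs_nonneg t).trans hN.le
  have hC := h.cmax_pos.le
  have hPL : IsPicardLindelof c (tmin := -N) (tmax := N) ⟨t, ht.1.le, ht.2.le⟩ y
      ⟨cmax * (2 * N), by positivity⟩ 0 ⟨cmax, hC⟩ L :=
    { lipschitzOnWith := fun s _ => (h.lipschitz s).lipschitzOnWith
      continuousOn := fun x _ =>
        (h.continuous.comp (by fun_prop : Continuous fun s : ℝ => (s, x))).continuousOn
      norm_le := fun s _ x _ => h.abs_le s x
      mul_max_le := by
        change cmax * max (N - t) (t - -N) ≤ cmax * (2 * N) - 0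
        rw [sub_zero]
        gcongr
        exact max_le (by linarith) (by linarith) }
  obtain ⟨γ, h0, hγ⟩ := hPL.exists_eq_forall_mem_Icc_hasDerivWithinAt₀
  exact ⟨γ, h0, fun s hs => (hγ s (Ioo_subset_Icc_self hs)).hasDerivAt (Icc_mem_nhds hs.1 hs.2)⟩

lemma exists_trajectory (h : IsSpeed c L cmin cmax) (t y : ℝ) :
    ∃ γ : ℝ → ℝ, γ t = y ∧ ∀ s, HasDerivAt γ (c s (γ s)) s := by
  have hN : ∀ s : ℝ, |t| < |s| + |t| + 1 := fun s => by linarith [abs_nonneg s]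
  choose γ hγ0 hγ using fun s : ℝ => h.exists_trajectory_Ioo t y (hN s)
  have hmem : ∀ s s' : ℝ, |s'| ≤ |s| → s' ∈ Ioo (-(|s| + |t| + 1)) (|s| + |t| + 1) := fun s s' hs =>
    abs_lt.1 (by linarith [abs_nonneg t])
  have heq : ∀ s s' : ℝ, |s'| ≤ |s| → γ s' s' = γ s s' := fun s s' hs => by
    have hsub : Ioo (-(|s'| + |t| + 1)) (|s'| + |t| + 1)
        ⊆ Ioo (-(|s| + |t| + 1)) (|s| + |t| + 1) := Ioo_subset_Ioo (by linarith) (by linarith)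
    exact ODE_solution_unique_of_mem_Ioo (s := fun _ => univ)
      (fun σ _ => (h.lipschitz σ).lipschitzOnWith)
      (abs_lt.1 (hN s')) (fun σ hσ => ⟨hγ s' σ hσ, trivial⟩)
      (fun σ hσ => ⟨hγ s σ (hsub hσ), trivial⟩) ((hγ0 s').trans (hγ0 s).symm)
      (hmem s' s' le_rfl)
  refine ⟨fun s => γ s s, hγ0 t, fun s => ?_⟩
  have h1 : |s| ≤ abs (|s| + 1) := (lt_add_one _).le.trans (le_abs_self _)
  have h2 := hγ (|s| + 1) s (hmem _ _ h1)
  rw [← heq _ _ h1] at h2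
  refine h2.congr_of_eventuallyEq ?_
  have hopen : ∀ᶠ s' in 𝓝 s, |s'| < |s| + 1 :=
    continuous_abs.continuousAt.eventually_lt_const (lt_add_one _)
  filter_upwards [hopen] with s' hs'
  exact heq _ _ (hs'.le.trans (le_abs_self _))

lemma exists_flow (h : IsSpeed c L cmin cmax) : ∃ Z, IsFlow c Z := by
  choose Z h0 hZ using h.exists_trajectory
  exact ⟨fun s t y => Z t y s, fun t y => h0 t y, fun s t y => hZ t y s⟩

end IsSpeed

lemma abs_sub_trajectory_le (hL : ∀ t, LipschitzWith L (c t)) {γ₁ γ₂ : ℝ → ℝ}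
    (h₁ : ∀ s, HasDerivAt γ₁ (c s (γ₁ s)) s) (h₂ : ∀ s, HasDerivAt γ₂ (c s (γ₂ s)) s) (s t : ℝ) :
    |γ₁ s - γ₂ s| ≤ Real.exp (L * |s - t|) * |γ₁ t - γ₂ t| := by
  have hd : ∀ k s, HasDerivAt (fun s => (γ₁ s - γ₂ s) ^ 2 * Real.exp (k * s))
      ((2 * (γ₁ s - γ₂ s) * (c s (γ₁ s) - c s (γ₂ s)) + k * (γ₁ s - γ₂ s) ^ 2)
        * Real.exp (k * s)) s := fun k s => by
    refine ((((h₁ s).sub (h₂ s)).pow 2).mul ((hasDerivAt_id s).const_mul k).exp).congr_deriv ?_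
    simp only [Pi.sub_apply, Pi.pow_apply, id]
    push_cast
    ring
  have hb : ∀ s, |2 * (γ₁ s - γ₂ s) * (c s (γ₁ s) - c s (γ₂ s))| ≤ 2 * L * (γ₁ s - γ₂ s) ^ 2 := by
    intro s
    have := (hL s).dist_le_mul (γ₁ s) (γ₂ s)
    rw [Real.dist_eq, Real.dist_eq] at this
    rw [abs_mul, abs_mul, abs_two, ← sq_abs (γ₁ s - γ₂ s)]
    have h0 := abs_nonneg (γ₁ s - γ₂ s)
    nlinarith
  have hanti : Antitone fun s => (γ₁ s - γ₂ s) ^ 2 * Real.exp (-(2 * L) * s) :=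
    antitone_of_hasDerivAt_nonpos (fun s => hd _ s) fun s =>
      mul_nonpos_of_nonpos_of_nonneg (by linarith [(abs_le.1 (hb s)).2]) (Real.exp_pos _).le
  have hmono : Monotone fun s => (γ₁ s - γ₂ s) ^ 2 * Real.exp (2 * L * s) :=
    monotone_of_hasDerivAt_nonneg (fun s => hd _ s) fun s =>
      mul_nonneg (by linarith [(abs_le.1 (hb s)).1]) (Real.exp_pos _).le
  have key : (γ₁ s - γ₂ s) ^ 2 ≤ (γ₁ t - γ₂ t) ^ 2 * Real.exp (2 * L * |s - t|) := by
    rcases le_total t s with hts | hts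
    · have h1 := mul_le_mul_of_nonneg_right (hanti hts) (Real.exp_pos (2 * L * s)).le
      simp only [mul_assoc _ (Real.exp _) (Real.exp _), ← Real.exp_add] at h1
      rw [abs_of_nonneg (sub_nonneg.2 hts)]
      rwa [show -(2 * (L : ℝ)) * s + 2 * L * s = 0 by ring, Real.exp_zero, mul_one,
        show -(2 * (L : ℝ)) * t + 2 * L * s = 2 * L * (s - t) by ring] at h1
    · have h1 := mul_le_mul_of_nonneg_right (hmono hts) (Real.exp_pos (-(2 * L * s))).le
      simp only [mul_assoc _ (Real.exp _) (Real.exp _), ← Real.exp_add] at h1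
      rw [abs_of_nonpos (sub_nonpos.2 hts)]
      rwa [add_neg_cancel, Real.exp_zero, mul_one,
        show 2 * (L : ℝ) * t + -(2 * L * s) = 2 * L * -(s - t) by ring] at h1
  refine abs_le_of_sq_le_sq' ?_ (by positivity) |> abs_le.2
  rw [mul_pow, sq_abs, ← Real.exp_nat_mul, mul_comm, Nat.cast_two, ← mul_assoc]
  exact key

namespace IsFlow

variable {Z : ℝ → ℝ → ℝ → ℝ}

lemma abs_sub_le (hZ : IsFlow c Z) (hL : ∀ t, LipschitzWith L (c t)) (s t y y' : ℝ) :
    |Z s t y - Z s t y'| ≤ Real.exp (L * |s - t|) * |y - y'| := by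
  have := abs_sub_trajectory_le hL (fun s => hZ.hasDerivAt s t y)
    (fun s => hZ.hasDerivAt s t y') s t
  rwa [hZ.self, hZ.self] at this

lemma comp (hZ : IsFlow c Z) (hL : ∀ t, LipschitzWith L (c t)) (s t r y : ℝ) :
    Z s t (Z t r y) = Z s r y := by
  have := abs_sub_trajectory_le hL (fun s => hZ.hasDerivAt s t (Z t r y))
    (fun s => hZ.hasDerivAt s r y) s t
  rw [hZ.self, sub_self, abs_zero, mul_zero] at this
  exact sub_eq_zero.1 (abs_nonpos_iff.1 this)

lemma continuous_time (hZ : IsFlow c Z) (t y : ℝ) : Continuous fun s => Z s t y :=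
  continuous_iff_continuousAt.2 fun s => (hZ.hasDerivAt s t y).continuousAt

lemma strictMono (hZ : IsFlow c Z) (hL : ∀ t, LipschitzWith L (c t)) (s t : ℝ) :
    StrictMono (Z s t) := by
  intro y y' hy
  by_contra hle
  rw [not_lt] at hle
  obtain ⟨σ, hσ⟩ := mem_range_of_exists_le_of_exists_ge
    ((hZ.continuous_time t y').sub (hZ.continuous_time t y)) (c := 0)
    ⟨s, sub_nonpos.2 hle⟩ ⟨t, by rw [Pi.sub_apply, hZ.self, hZ.self]; exact sub_nonneg.2 hy.le⟩
  have h1 : Z σ t y' = Z σ t y := sub_eq_zero.1 hσ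
  have h2 := hZ.comp hL t σ t y
  rw [← h1, hZ.comp hL, hZ.self, hZ.self] at h2
  exact hy.ne' h2

/-- The Lipschitz constant of the flow between two times. -/
noncomputable def expDist (L : ℝ≥0) (s t : ℝ) : ℝ≥0 := (Real.exp (L * |s - t|)).toNNReal

lemma coe_expDist (L : ℝ≥0) (s t : ℝ) : (expDist L s t : ℝ) = Real.exp (L * |s - t|) :=
  Real.coe_toNNReal _ (Real.exp_pos _).le

lemma increasingBiLipschitz (hZ : IsFlow c Z) (hL : ∀ t, LipschitzWith L (c t)) (s t : ℝ) :
    IncreasingBiLipschitz (expDist L s t) (Z s t) (Z t s) where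
  strictMono := hZ.strictMono hL s t
  lipschitz := LipschitzWith.of_dist_le_mul fun y y' => by
    rw [coe_expDist]
    exact hZ.abs_sub_le hL s t y y'
  lipschitz_inv := LipschitzWith.of_dist_le_mul fun y y' => by
    rw [coe_expDist, abs_sub_comm s t]
    exact hZ.abs_sub_le hL t s y y'
  left_inv y := by rw [hZ.comp hL, hZ.self]
  right_inv y := by rw [hZ.comp hL, hZ.self]

lemma abs_sub_time_le (hZ : IsFlow c Z) (h : IsSpeed c L cmin cmax) (s s' t y : ℝ) :
    |Z s t y - Z s' t y| ≤ cmax * |s - s'| :=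
  convex_univ.norm_image_sub_le_of_norm_hasDerivWithin_le
    (fun σ _ => (hZ.hasDerivAt σ t y).hasDerivWithinAt) (fun σ _ => h.abs_le σ _)
    (mem_univ s') (mem_univ s)

lemma continuous_uncurry (hZ : IsFlow c Z) (h : IsSpeed c L cmin cmax) (t : ℝ) :
    Continuous fun z : ℝ × ℝ => Z z.1 t z.2 := by
  refine continuous_iff_continuousAt.2 fun z₀ => ?_
  rw [ContinuousAt, tendsto_iff_dist_tendsto_zero]
  have hlim : Tendsto (fun z : ℝ × ℝ => Real.exp (L * |z.1 - t|) * |z.2 - z₀.2|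
      + cmax * |z.1 - z₀.1|) (𝓝 z₀) (𝓝 0) := by
    have : Continuous (fun z : ℝ × ℝ => Real.exp (L * |z.1 - t|) * |z.2 - z₀.2|
      + cmax * |z.1 - z₀.1|) := by fun_prop
    simpa using this.tendsto z₀
  refine squeeze_zero (fun _ => dist_nonneg) (fun z => ?_) hlim
  refine (dist_triangle _ (Z z.1 t z₀.2) _).trans (add_le_add ?_ ?_)
  · exact hZ.abs_sub_le h.lipschitz _ _ _ _
  · exact hZ.abs_sub_time_le h _ _ _ _

lemma strictMono_time (hZ : IsFlow c Z) (h : IsSpeed c L cmin cmax) (t y : ℝ) :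
    StrictMono fun s => Z s t y :=
  strictMono_of_hasDerivAt_pos (fun s => hZ.hasDerivAt s t y) fun _ => h.pos.trans_le (h.le _ _)

lemma eq_sub_integral (hZ : IsFlow c Z) (h : IsSpeed c L cmin cmax) (s t y : ℝ) :
    Z s t y = y - ∫ σ in s..t, c σ (Z σ t y) := by
  have hcont : Continuous fun σ => c σ (Z σ t y) :=
    h.continuous.comp (continuous_id.prodMk (hZ.continuous_time t y))
  rw [intervalIntegral.integral_eq_sub_of_hasDerivAt (fun σ _ => hZ.hasDerivAt σ t y)
    (hcont.intervalIntegrable _ _), hZ.self]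
  ring

lemma zero_eq_neg_integral (hZ : IsFlow c Z) (h : IsSpeed c L cmin cmax)
    (hc : ∀ t x, x ≤ 0 → c t x = c t 0) {t : ℝ} (ht : 0 ≤ t) :
    Z 0 t 0 = -∫ σ in (0 : ℝ)..t, c σ 0 := by
  rw [hZ.eq_sub_integral h, zero_sub]
  congr 1
  refine intervalIntegral.integral_congr fun σ hσ => hc _ _ ?_
  rw [uIcc_of_le ht] at hσ
  have := (hZ.strictMono_time h t 0).monotone hσ.2
  simpa only [hZ.self] using this

end IsFlow

section Travel

/-- Distance travelled up to time `t` at speed `a`. -/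
noncomputable def travel (a : ℝ → ℝ) (t : ℝ) : ℝ := ∫ s in (0 : ℝ)..t, a s

/-- Time needed to travel a given distance at speed `a`. -/
noncomputable def arrival (a : ℝ → ℝ) : ℝ → ℝ := Function.invFun (travel a)

variable {a : ℝ → ℝ} {amin amax : ℝ}

lemma travel_zero (a : ℝ → ℝ) : travel a 0 = 0 := intervalIntegral.integral_same

lemma hasDerivAt_travel (ha : Continuous a) (t : ℝ) : HasDerivAt (travel a) (a t) t :=
  hasDerivAt_integral_of_continuous ha 0 t

lemma travel_sub_bounds (ha : Continuous a) (hmin : ∀ t, amin ≤ a t) (hmax : ∀ t, a t ≤ amax)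
    {s t : ℝ} (hst : s ≤ t) :
    amin * (t - s) ≤ travel a t - travel a s ∧ travel a t - travel a s ≤ amax * (t - s) := by
  have e : travel a t - travel a s = ∫ σ in s..t, a σ := by
    rw [travel, travel, sub_eq_iff_eq_add', intervalIntegral.integral_add_adjacent_intervals
      (ha.intervalIntegrable _ _) (ha.intervalIntegrable _ _)]
  have e' : ∀ k : ℝ, k * (t - s) = ∫ _ in s..t, k := fun k => by
    rw [intervalIntegral.integral_const, smul_eq_mul, mul_comm]
  rw [e, e', e']
  exact ⟨intervalIntegral.integral_mono hst intervalIntegrable_const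
    (ha.intervalIntegrable _ _) fun s => hmin s, intervalIntegral.integral_mono hst
    (ha.intervalIntegrable _ _) intervalIntegrable_const fun s => hmax s⟩

lemma abs_travel_sub_le (ha : Continuous a) (h0 : 0 ≤ amin) (hmin : ∀ t, amin ≤ a t)
    (hmax : ∀ t, a t ≤ amax) (s t : ℝ) :
    amin * |t - s| ≤ |travel a t - travel a s| ∧ |travel a t - travel a s| ≤ amax * |t - s| := by
  wlog hst : s ≤ t generalizing s t
  · rw [abs_sub_comm t s, abs_sub_comm (travel a t)]
    exact this t s (not_le.1 hst).le
  have h := travel_sub_bounds ha hmin hmax hst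
  have h1 : 0 ≤ travel a t - travel a s := (mul_nonneg h0 (sub_nonneg.2 hst)).trans h.1
  rwa [abs_of_nonneg (sub_nonneg.2 hst), abs_of_nonneg h1]

lemma strictMono_travel (ha : Continuous a) (h0 : 0 < amin) (hmin : ∀ t, amin ≤ a t) :
    StrictMono (travel a) :=
  strictMono_of_hasDerivAt_pos (hasDerivAt_travel ha) fun t => h0.trans_le (hmin t)

lemma surjective_travel (ha : Continuous a) (h0 : 0 < amin) (hmin : ∀ t, amin ≤ a t)
    (hmax : ∀ t, a t ≤ amax) : Function.Surjective (travel a) := by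
  have hc : Continuous (travel a) :=
    continuous_iff_continuousAt.2 fun t => (hasDerivAt_travel ha t).continuousAt
  refine hc.surjective ?_ ?_
  · refine tendsto_atTop_mono' _ ?_ (tendsto_id.const_mul_atTop h0)
    filter_upwards [eventually_ge_atTop 0] with t ht
    have := (travel_sub_bounds ha hmin hmax ht).1
    simpa [travel_zero] using this
  · refine tendsto_atBot_mono' _ ?_ (tendsto_id.const_mul_atBot h0)
    filter_upwards [eventually_le_atBot 0] with t ht
    have := (travel_sub_bounds ha hmin hmax ht).1
    rw [travel_zero] at this
    simp only [id]
    linarith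

/-- A Lipschitz constant for both `travel a` and its inverse. -/
noncomputable def travelConst (amin amax : ℝ) : ℝ≥0 := max amin⁻¹.toNNReal amax.toNNReal

lemma increasingBiLipschitz_travel (ha : Continuous a) (h0 : 0 < amin) (hmin : ∀ t, amin ≤ a t)
    (hmax : ∀ t, a t ≤ amax) :
    IncreasingBiLipschitz (travelConst amin amax) (travel a) (arrival a) := by
  have hmono := strictMono_travel ha h0 hmin
  have hr : ∀ x, travel a (arrival a x) = x :=
    Function.rightInverse_invFun (surjective_travel ha h0 hmin hmax)
  refine ⟨hmono, ?_, ?_, Function.leftInverse_invFun hmono.injective, hr⟩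
  · refine LipschitzWith.of_dist_le_mul fun t s => ?_
    refine (abs_travel_sub_le ha h0.le hmin hmax s t).2.trans ?_
    rw [Real.dist_eq, travelConst]
    gcongr
    exact (Real.le_coe_toNNReal _).trans (NNReal.coe_le_coe.2 (le_max_right _ _))
  · refine LipschitzWith.of_dist_le_mul fun x y => ?_
    have h1 := (abs_travel_sub_le ha h0.le hmin hmax (arrival a y) (arrival a x)).1
    rw [hr, hr] at h1
    rw [Real.dist_eq, Real.dist_eq, travelConst]
    have h2 : |arrival a x - arrival a y| ≤ amin⁻¹ * |x - y| := by
      rw [← div_eq_inv_mul, le_div_iff₀ h0, mul_comm]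
      exact h1
    refine h2.trans ?_
    gcongr
    exact (Real.le_coe_toNNReal _).trans (NNReal.coe_le_coe.2 (le_max_left _ _))

end Travel

end RoadTraffic

namespace RoadTraffic
open Filter Topology NNReal

/-- Initial data on the whole line: on `x ≤ 0` it encodes the inflow `u` at speed `a`. -/
noncomputable def entryData (a q₀ u : ℝ → ℝ) (x : ℝ) : ℝ :=
  if 0 < x then q₀ x else u (arrival a (-x)) * deriv (arrival a) (-x)

/-- The density at time `t` obtained by transporting the density `m` at time `0` along `Z`. -/
noncomputable def transported (Z : ℝ → ℝ → ℝ → ℝ) (m : ℝ → ℝ) (t y : ℝ) : ℝ :=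
  m (Z 0 t y) * deriv (Z 0 t) y

section EntryData

variable {a q₀ u : ℝ → ℝ} {amin amax M : ℝ}

lemma measurable_entryData (ha : Continuous a) (h0 : 0 < amin) (hmin : ∀ t, amin ≤ a t)
    (hmax : ∀ t, a t ≤ amax) (hq : Measurable q₀) (hu : Measurable u) :
    Measurable (entryData a q₀ u) := by
  have h := (increasingBiLipschitz_travel ha h0 hmin hmax).symm
  exact Measurable.ite measurableSet_Ioi hq ((h.measurable_deriv_mul_comp hu).comp measurable_neg)

lemma abs_entryData_le (ha : Continuous a) (h0 : 0 < amin) (hmin : ∀ t, amin ≤ a t)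
    (hmax : ∀ t, a t ≤ amax) (hq : ∀ x, |q₀ x| ≤ M) (hu : ∀ t, |u t| ≤ M) (x : ℝ) :
    |entryData a q₀ u x| ≤ M + M * travelConst amin amax := by
  have h := (increasingBiLipschitz_travel ha h0 hmin hmax).symm
  have hM : 0 ≤ M := (abs_nonneg _).trans (hq 0)
  rw [entryData]
  split_ifs
  · exact (hq x).trans (le_add_of_nonneg_right (by positivity))
  · exact (h.abs_comp_mul_deriv_le hu (-x)).trans (le_add_of_nonneg_left hM)

lemma entryData_nonneg (ha : Continuous a) (h0 : 0 < amin) (hmin : ∀ t, amin ≤ a t)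
    (hmax : ∀ t, a t ≤ amax) (hq : ∀ x, 0 ≤ q₀ x) (hu : ∀ t, 0 ≤ u t) (x : ℝ) :
    0 ≤ entryData a q₀ u x := by
  have h := (increasingBiLipschitz_travel ha h0 hmin hmax).symm
  rw [entryData]
  split_ifs
  · exact hq x
  · exact mul_nonneg (hu _) (h.deriv_nonneg _)

lemma integral_entryData_neg (ha : Continuous a) (h0 : 0 < amin) (hmin : ∀ t, amin ≤ a t)
    (hmax : ∀ t, a t ≤ amax) (g : ℝ → ℝ) {s t : ℝ} (hs : 0 ≤ s) (hst : s ≤ t) :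
    ∫ x in -t..-s, entryData a q₀ u x * g (arrival a (-x))
      = ∫ σ in arrival a s..arrival a t, u σ * g σ := by
  have h := (increasingBiLipschitz_travel ha h0 hmin hmax).symm
  rw [← h.integral_comp_mul_deriv, ← intervalIntegral.integral_comp_neg]
  refine intervalIntegral.integral_congr fun x hx => ?_
  rw [uIcc_of_le hst] at hx
  simp only [entryData, if_neg (not_lt.2 (neg_nonpos.2 (hs.trans hx.1))), neg_neg]
  ring

end EntryData

variable {T ℓ : ℝ} {c : ℝ → ℝ → ℝ} {L : ℝ≥0} {cmin cmax : ℝ} {Z : ℝ → ℝ → ℝ → ℝ} {m : ℝ → ℝ} {M : ℝ}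

namespace IsFlow

lemma measurable_transported (hZ : IsFlow c Z) (h : IsSpeed c L cmin cmax) (hm : Measurable m)
    (t : ℝ) : Measurable (transported Z m t) :=
  (hZ.increasingBiLipschitz h.lipschitz 0 t).measurable_deriv_mul_comp hm

lemma abs_transported_le (hZ : IsFlow c Z) (h : IsSpeed c L cmin cmax) (hm : ∀ x, |m x| ≤ M)
    (t y : ℝ) : |transported Z m t y| ≤ M * Real.exp (L * |t|) := by
  have := (hZ.increasingBiLipschitz h.lipschitz 0 t).abs_comp_mul_deriv_le hm y
  rwa [coe_expDist, zero_sub, abs_neg] at this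

lemma transported_nonneg (hZ : IsFlow c Z) (h : IsSpeed c L cmin cmax) (hm : ∀ x, 0 ≤ m x)
    (t y : ℝ) : 0 ≤ transported Z m t y :=
  mul_nonneg (hm _) ((hZ.increasingBiLipschitz h.lipschitz 0 t).deriv_nonneg y)

lemma integral_transported (hZ : IsFlow c Z) (h : IsSpeed c L cmin cmax) (t : ℝ) (a b : ℝ) :
    ∫ y in a..b, transported Z m t y = ∫ x in Z 0 t a..Z 0 t b, m x :=
  (hZ.increasingBiLipschitz h.lipschitz 0 t).integral_comp_mul_deriv m a b

lemma transported_eq_pullback (hZ : IsFlow c Z) (h : IsSpeed c L cmin cmax) (s t : ℝ) :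
    ∀ᵐ y, transported Z m t y = transported Z m s (Z s t y) * deriv (Z s t) y := by
  have h1 := hZ.increasingBiLipschitz h.lipschitz s t
  have h2 := hZ.increasingBiLipschitz h.lipschitz 0 s
  filter_upwards [h1.lipschitz.ae_differentiableAt_real,
    h1.ae_comp h2.lipschitz.ae_differentiableAt_real] with y hy1 hy2
  have e : Z 0 t = Z 0 s ∘ Z s t := funext fun y => (hZ.comp h.lipschitz 0 s t y).symm
  rw [transported, transported, e, deriv_comp y hy2 hy1, Function.comp, mul_assoc]

lemma continuousInL1_transported (hZ : IsFlow c Z) (h : IsSpeed c L cmin cmax) (hℓ : 0 ≤ ℓ)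
    (hmm : Measurable m) (hm : ∀ x, |m x| ≤ M) : ContinuousInL1 T ℓ (transported Z m) := by
  intro s hs
  have hbound := hZ.abs_transported_le h hm s
  have hmeas := hZ.measurable_transported h hmm s
  refine ⟨intervalIntegrable_of_measurable_of_bound hmeas hbound _ _, ?_⟩
  set I : Set ℝ := Icc (-(cmax * T)) (ℓ + cmax * T) with hI
  set f : ℝ → ℝ := I.indicator (transported Z m s) with hf
  have hfm : Measurable f := hmeas.indicator measurableSet_Icc
  have hfb : ∀ x, |f x| ≤ M * Real.exp (L * |s|) := fun x => by
    by_cases hx : x ∈ I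
    · rw [hf, indicator_of_mem hx]; exact hbound x
    · rw [hf, indicator_of_notMem hx, abs_zero]; exact (abs_nonneg _).trans (hbound 0)
  have hfi : Integrable f := by
    rw [hf, integrable_indicator_iff measurableSet_Icc]
    exact Measure.integrableOn_of_bounded measure_Icc_lt_top.ne hmeas.aestronglyMeasurable
      (Eventually.of_forall hbound)
  have hη : ∀ t y, |Z s t y - y| ≤ cmax * |s - t| := fun t y => by
    have := hZ.abs_sub_time_le h s t t y
    rwa [hZ.self] at this
  have hK : Tendsto (fun t => (expDist L s t : ℝ)) (𝓝[Icc 0 T] s) (𝓝 1) := by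
    simp_rw [coe_expDist]
    have : Continuous fun t => Real.exp (L * |s - t|) := by fun_prop
    simpa using (this.tendsto s).mono_left nhdsWithin_le_nhds
  have hη0 : Tendsto (fun t => cmax * |s - t|) (𝓝[Icc 0 T] s) (𝓝 0) := by
    have : Continuous fun t => cmax * |s - t| := by fun_prop
    simpa using (this.tendsto s).mono_left nhdsWithin_le_nhds
  have key := tendsto_integral_abs_pullback_sub hℓ
    (fun t => hZ.increasingBiLipschitz h.lipschitz s t) hK hη0 hη hfi hfm hfb
  refine key.congr' ?_
  filter_upwards [self_mem_nhdsWithin] with t ht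
  have hAst : cmax * |s - t| ≤ cmax * T :=
    mul_le_mul_of_nonneg_left (abs_sub_le_iff.2 ⟨by linarith [hs.2, ht.1], by linarith [ht.2, hs.1]⟩)
      h.cmax_pos.le
  have hA : 0 ≤ cmax * T := (mul_nonneg h.cmax_pos.le (abs_nonneg _)).trans hAst
  refine intervalIntegral.integral_congr_ae ?_
  filter_upwards [hZ.transported_eq_pullback h s t (m := m)] with y hy hy'
  rw [uIoc_of_le hℓ] at hy'
  have h1 := abs_le.1 ((hη t y).trans hAst)
  have hyI : y ∈ I := ⟨by linarith [hy'.1], by linarith [hy'.2]⟩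
  have hZI : Z s t y ∈ I := ⟨by linarith [hy'.1], by linarith [hy'.2]⟩
  rw [hf, indicator_of_mem hyI, indicator_of_mem hZI, hy]

end IsFlow

end RoadTraffic

namespace RoadTraffic
open Filter Topology NNReal

variable {T ℓ : ℝ} {c : ℝ → ℝ → ℝ} {L : ℝ≥0} {cmin cmax : ℝ} {Z : ℝ → ℝ → ℝ → ℝ}
  {q₀ u : ℝ → ℝ} {M : ℝ}

/-- `∂ₜ φ + c ∂ₓ φ`. -/
noncomputable def materialDeriv (c : ℝ → ℝ → ℝ) (φ : ℝ × ℝ → ℝ) (t x : ℝ) : ℝ :=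
  fderiv ℝ φ (t, x) (1, 0) + c t x * fderiv ℝ φ (t, x) (0, 1)

section MaterialDeriv

variable {φ : ℝ × ℝ → ℝ}

lemma continuous_materialDeriv (h : IsSpeed c L cmin cmax) (hφ : ContDiff ℝ 1 φ) :
    Continuous fun z : ℝ × ℝ => materialDeriv c φ z.1 z.2 := by
  have hd : Continuous (fderiv ℝ φ) := hφ.continuous_fderiv one_ne_zero
  exact (hd.clm_apply continuous_const).add (h.continuous.mul (hd.clm_apply continuous_const))

lemma materialDeriv_eq_zero (hφ : IsTestFunction T ℓ φ) {t x : ℝ} (hx : ℓ ≤ x) :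
    materialDeriv c φ t x = 0 := by
  have : fderiv ℝ φ (t, x) = 0 := fderiv_of_notMem_tsupport ℝ fun hmem =>
    absurd (hφ.2 hmem).2 (not_lt.2 hx)
  simp [materialDeriv, this]

lemma testFunction_eq_zero (hφ : IsTestFunction T ℓ φ) {t x : ℝ} (ht : T ≤ t) : φ (t, x) = 0 :=
  image_eq_zero_of_notMem_tsupport fun hmem => absurd (hφ.2 hmem).1 (not_lt.2 ht)

lemma IsFlow.hasDerivAt_comp (hZ : IsFlow c Z) (hφ : ContDiff ℝ 1 φ) (s t x : ℝ) :
    HasDerivAt (fun s => φ (s, Z s t x)) (materialDeriv c φ s (Z s t x)) s := by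
  have h1 : HasDerivAt (fun s => (s, Z s t x)) ((1 : ℝ), c s (Z s t x)) s :=
    (hasDerivAt_id s).prodMk (hZ.hasDerivAt s t x)
  have h2 := ((hφ.differentiable one_ne_zero) (s, Z s t x)).hasFDerivAt.comp_hasDerivAt s h1
  refine h2.congr_deriv ?_
  rw [materialDeriv, show ((1 : ℝ), c s (Z s t x)) = (1, 0) + c s (Z s t x) • ((0 : ℝ), (1 : ℝ)) by
    ext <;> simp, map_add, map_smul, smul_eq_mul]

lemma IsFlow.integral_materialDeriv (hZ : IsFlow c Z) (h : IsSpeed c L cmin cmax)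
    (hφ : IsTestFunction T ℓ φ) (s t x : ℝ) :
    ∫ σ in s..T, materialDeriv c φ σ (Z σ t x) = -φ (s, Z s t x) := by
  have hc : Continuous fun σ => materialDeriv c φ σ (Z σ t x) :=
    (continuous_materialDeriv h hφ.1).comp (continuous_id.prodMk (hZ.continuous_time t x))
  rw [intervalIntegral.integral_eq_sub_of_hasDerivAt (fun σ _ => hZ.hasDerivAt_comp hφ.1 σ t x)
    (hc.intervalIntegrable _ _), testFunction_eq_zero hφ le_rfl, zero_sub]

end MaterialDeriv

/-- The transported entry data solves the linear transport equation in the weak sense. -/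
theorem IsFlow.weakForm_transported (hZ : IsFlow c Z) (h : IsSpeed c L cmin cmax)
    (hc : ∀ t x, x ≤ 0 → c t x = c t 0) (hT : 0 < T) (hℓ : 0 < ℓ) (hqm : Measurable q₀)
    (hum : Measurable u) (hq : ∀ x, |q₀ x| ≤ M) (hu : ∀ t, |u t| ≤ M) :
    WeakForm T ℓ c q₀ u (transported Z (entryData (fun t => c t 0) q₀ u)) := by
  intro φ hφ
  set a : ℝ → ℝ := fun t => c t 0 with ha_def
  set m : ℝ → ℝ := entryData a q₀ u with hm_def
  have ha : Continuous a := h.continuous.comp (by fun_prop : Continuous fun t : ℝ => (t, (0 : ℝ)))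
  have hmin : ∀ t, cmin ≤ a t := fun t => h.le t 0
  have hmax : ∀ t, a t ≤ cmax := fun t => h.ge t 0
  have hbi := increasingBiLipschitz_travel ha h.pos hmin hmax
  have hmm : Measurable m := measurable_entryData ha h.pos hmin hmax hqm hum
  have hmb := abs_entryData_le ha h.pos hmin hmax hq hu
  have hZ0 : ∀ t, 0 ≤ t → Z 0 t 0 = -travel a t := fun t ht => hZ.zero_eq_neg_integral h hc ht
  have htr0 : ∀ t, 0 ≤ t → 0 ≤ travel a t := fun t ht => by
    simpa only [travel_zero] using hbi.strictMono.monotone ht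
  have har0 : arrival a 0 = 0 := by simpa only [travel_zero] using hbi.left_inv 0
  set A : ℝ := travel a T with hA
  have hA0 : 0 ≤ A := htr0 T hT.le
  set ψ : ℝ → ℝ → ℝ := materialDeriv c φ with hψ
  have hψc : Continuous fun z : ℝ × ℝ => ψ z.1 (Z z.1 0 z.2) :=
    (continuous_materialDeriv h hφ.1).comp
      (continuous_fst.prodMk (hZ.continuous_uncurry h 0))
  set F : ℝ → ℝ → ℝ := fun t => (Ioi (-travel a t)).indicator fun x => m x * ψ t (Z t 0 x) with hF
  -- passing to Lagrangian coordinates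
  have hslice : ∀ t ∈ Icc 0 T, ∫ y in (0 : ℝ)..ℓ, transported Z m t y * ψ t y
      = ∫ x in -A..ℓ, F t x := by
    intro t ht
    have hb := hZ.increasingBiLipschitz h.lipschitz 0 t
    have htA : travel a t ≤ A := hbi.strictMono.monotone ht.2
    have hZℓ : Z 0 t ℓ ≤ ℓ := by
      simpa only [hZ.self] using (hZ.strictMono_time h t ℓ).monotone ht.1
    have hZℓ0 : -travel a t ≤ Z 0 t ℓ := by
      rw [← hZ0 t ht.1]
      exact hb.strictMono.monotone hℓ.le
    have e1 := hb.integral_comp_mul_deriv (fun x => m x * ψ t (Z t 0 x)) 0 ℓ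
    simp only [hb.left_inv] at e1
    have e2 : ∫ y in (0 : ℝ)..ℓ, transported Z m t y * ψ t y
        = ∫ y in (0 : ℝ)..ℓ, m (Z 0 t y) * ψ t y * deriv (Z 0 t) y :=
      intervalIntegral.integral_congr fun y _ => by simp only [transported]; ring
    rw [e2, e1, hZ0 t ht.1, intervalIntegral.integral_of_le hZℓ0,
      intervalIntegral.integral_of_le (by linarith), hF, setIntegral_indicator measurableSet_Ioi]
    refine (setIntegral_eq_of_subset_of_forall_sdiff_eq_zero
      (measurableSet_Ioc.inter measurableSet_Ioi)
      (fun x hx => ⟨⟨by linarith [hx.1], hx.2.trans hZℓ⟩, hx.1⟩) fun x hx => ?_).symm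
    have hx' : Z 0 t ℓ < x := lt_of_not_ge fun hle => hx.2 ⟨hx.1.2, hle⟩
    have : ℓ ≤ Z t 0 x := by
      rw [← hb.left_inv ℓ]
      exact hb.symm.strictMono.monotone hx'.le
    rw [hψ, materialDeriv_eq_zero hφ this, mul_zero]
  have hFint : IntegrableOn F.uncurry (uIoc 0 T ×ˢ uIoc (-A) ℓ) := by
    obtain ⟨B, hB⟩ := (isCompact_uIcc.prod isCompact_uIcc :
      IsCompact (uIcc 0 T ×ˢ uIcc (-A) ℓ)).exists_bound_of_continuousOn hψc.continuousOn
    have hFm : Measurable F.uncurry := by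
      have hset : MeasurableSet {z : ℝ × ℝ | -travel a z.1 < z.2} :=
        measurableSet_lt (hbi.lipschitz.continuous.comp continuous_fst).neg.measurable
          measurable_snd
      exact ((hmm.comp measurable_snd).mul hψc.measurable).indicator hset
    refine Measure.integrableOn_of_bounded (M := (M + M * travelConst cmin cmax) * B) ?_
      hFm.aestronglyMeasurable ?_
    · rw [Measure.volume_eq_prod, Measure.prod_prod]
      exact ENNReal.mul_ne_top (by simp [uIoc]) (by simp [uIoc])
    · refine ae_restrict_of_forall_mem (measurableSet_uIoc.prod measurableSet_uIoc) fun z hz => ?_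
      have h1 := hB z ⟨uIoc_subset_uIcc hz.1, uIoc_subset_uIcc hz.2⟩
      change ‖(Ioi (-travel a z.1)).indicator (fun x => m x * ψ z.1 (Z z.1 0 x)) z.2‖ ≤ _
      refine (norm_indicator_le_norm_self _ _).trans ?_
      rw [norm_mul]
      exact mul_le_mul (hmb _) h1 (norm_nonneg _) ((abs_nonneg _).trans (hmb 0))
  have hpos : ∀ x ∈ Ioc 0 ℓ, ∫ t in (0 : ℝ)..T, F t x = -(q₀ x * φ (0, x)) := by
    intro x hx
    have e1 : ∫ t in (0 : ℝ)..T, F t x = ∫ t in (0 : ℝ)..T, m x * ψ t (Z t 0 x) := by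
      refine intervalIntegral.integral_congr fun t ht => ?_
      rw [uIcc_of_le hT.le] at ht
      exact indicator_of_mem (show -travel a t < x by linarith [htr0 t ht.1, hx.1]) _
    rw [e1, intervalIntegral.integral_const_mul, hZ.integral_materialDeriv h hφ, hZ.self,
      hm_def, entryData, if_pos hx.1, mul_neg]
  have hneg : ∀ x ∈ Icc (-A) 0, ∫ t in (0 : ℝ)..T, F t x
      = -(m x * φ (arrival a (-x), 0)) := by
    intro x hx
    set τ : ℝ := arrival a (-x) with hτ
    have hτx : travel a τ = -x := hbi.right_inv (-x)
    have hτ0 : 0 ≤ τ := by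
      rw [← har0]
      exact hbi.symm.strictMono.monotone (neg_nonneg.2 hx.2)
    have hτT : τ ≤ T := by
      rw [← hbi.left_inv T]
      exact hbi.symm.strictMono.monotone (by linarith [hx.1])
    have hZτ : Z τ 0 x = 0 := by
      have : Z 0 τ 0 = x := by rw [hZ0 τ hτ0, hτx, neg_neg]
      rw [← this, hZ.comp h.lipschitz, hZ.self]
    have hiff : ∀ t, -travel a t < x ↔ τ < t := fun t => by
      rw [← hbi.strictMono.lt_iff_lt (a := τ), hτx]
      exact neg_lt
    have e1 : ∀ t, F t x = (Ioi τ).indicator (fun t => m x * ψ t (Z t 0 x)) t := fun t => by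
      by_cases ht : τ < t
      · rw [indicator_of_mem (show t ∈ Ioi τ from ht)]
        exact indicator_of_mem (show x ∈ Ioi (-travel a t) from (hiff t).2 ht) _
      · rw [indicator_of_notMem (show t ∉ Ioi τ from ht)]
        exact indicator_of_notMem (show x ∉ Ioi (-travel a t) from fun hx => ht ((hiff t).1 hx)) _
    simp_rw [e1]
    rw [intervalIntegral.integral_of_le hT.le, setIntegral_indicator measurableSet_Ioi,
      Ioc_inter_Ioi, max_eq_right hτ0, ← intervalIntegral.integral_of_le hτT,
      intervalIntegral.integral_const_mul, hZ.integral_materialDeriv h hφ, hZτ, mul_neg]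
  have hmain : ∫ t in (0 : ℝ)..T, ∫ y in (0 : ℝ)..ℓ, transported Z m t y * ψ t y
      = (∫ x in -A..0, -(m x * φ (arrival a (-x), 0))) + ∫ x in (0 : ℝ)..ℓ, -(q₀ x * φ (0, x)) := by
    rw [intervalIntegral.integral_congr (g := fun t => ∫ x in -A..ℓ, F t x) fun t ht => by
      rw [uIcc_of_le hT.le] at ht
      exact hslice t ht, intervalIntegral_intervalIntegral_swap hFint]
    have i1 : IntervalIntegrable (fun x => -(m x * φ (arrival a (-x), 0))) volume (-A) 0 := by
      refine ((intervalIntegrable_of_measurable_of_bound hmm hmb _ _).mul_continuousOn ?_).neg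
      have := hφ.1.continuous
      have := hbi.lipschitz_inv.continuous
      fun_prop
    have i2 : IntervalIntegrable (fun x => -(q₀ x * φ (0, x))) volume 0 ℓ := by
      refine ((intervalIntegrable_of_measurable_of_bound hqm hq _ _).mul_continuousOn ?_).neg
      have := hφ.1.continuous
      fun_prop
    have j1 : EqOn (fun x => -(m x * φ (arrival a (-x), 0))) (fun x => ∫ t in (0 : ℝ)..T, F t x)
        (uIoc (-A) 0) := fun x hx => by
      rw [uIoc_of_le (by linarith)] at hx
      exact (hneg x (Ioc_subset_Icc_self hx)).symm
    have j2 : EqOn (fun x => -(q₀ x * φ (0, x))) (fun x => ∫ t in (0 : ℝ)..T, F t x)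
        (uIoc 0 ℓ) := fun x hx => by
      rw [uIoc_of_le hℓ.le] at hx
      exact (hpos x hx).symm
    rw [← intervalIntegral.integral_add_adjacent_intervals (i1.congr j1) (i2.congr j2),
      intervalIntegral.integral_congr_ae (Eventually.of_forall fun _ hx => j1 hx),
      intervalIntegral.integral_congr_ae (Eventually.of_forall fun _ hx => j2 hx)]
  have hbdry : ∫ x in -A..0, m x * φ (arrival a (-x), 0) = ∫ t in (0 : ℝ)..T, u t * φ (t, 0) := by
    have := integral_entryData_neg (q₀ := q₀) (u := u) ha h.pos hmin hmax (fun t => φ (t, 0))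
      le_rfl hA0
    rwa [neg_zero, har0, hA, hbi.left_inv] at this
  change (∫ t in (0 : ℝ)..T, ∫ y in (0 : ℝ)..ℓ, transported Z m t y * ψ t y) + _ + _ = 0
  rw [hmain, intervalIntegral.integral_neg, intervalIntegral.integral_neg, hbdry]
  ring

end RoadTraffic

namespace RoadTraffic
open Filter Topology NNReal

variable {T ℓ : ℝ}

/-- Volterra operators on `C([0, T])` have fixed points. -/
lemma exists_fixedPoint_volterra (hT : 0 ≤ T) {G : (ℝ → ℝ) → ℝ → ℝ}
    (hGc : ∀ w, Continuous w → Continuous (G w)) {K : ℝ} (hK : 0 ≤ K)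
    (hG : ∀ w₁ w₂, Continuous w₁ → Continuous w₂ → ∀ t ∈ Icc 0 T,
      |G w₁ t - G w₂ t| ≤ K * ∫ s in (0 : ℝ)..t, |w₁ s - w₂ s|) :
    ∃ w, Continuous w ∧ ∀ t ∈ Icc 0 T, w t = G w t := by
  set k : ℝ := 2 * K + 1 with hk
  have hk0 : 0 < k := by positivity
  set E : C(Icc (0 : ℝ) T, ℝ) → ℝ → ℝ := fun η t => Real.exp (k * t) * IccExtend hT η t with hE
  have hEc : ∀ η, Continuous (E η) := fun η =>
    (by fun_prop : Continuous fun t => Real.exp (k * t)).mul η.continuous.Icc_extend'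
  set Φ : C(Icc (0 : ℝ) T, ℝ) → C(Icc (0 : ℝ) T, ℝ) := fun η =>
    ⟨fun t => Real.exp (-(k * t)) * G (E η) t, by have := hGc _ (hEc η); fun_prop⟩ with hΦ
  have hcontr : ContractingWith (1 / 2 : ℝ≥0) Φ := by
    refine ⟨by rw [div_lt_one two_pos]; exact one_lt_two, LipschitzWith.of_dist_le_mul fun η₁ η₂ => ?_⟩
    refine (ContinuousMap.dist_le (by positivity)).2 fun t => ?_
    have ht := t.2
    have h1 : ∫ s in (0 : ℝ)..t, |E η₁ s - E η₂ s|
        ≤ ∫ s in (0 : ℝ)..t, Real.exp (k * s) * dist η₁ η₂ := by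
      refine intervalIntegral.integral_mono_on ht.1
        (((hEc η₁).sub (hEc η₂)).abs.intervalIntegrable _ _)
        (Continuous.intervalIntegrable (by fun_prop) _ _) fun s _ => ?_
      rw [hE, ← mul_sub, abs_mul, abs_of_pos (Real.exp_pos _)]
      gcongr
      exact ContinuousMap.dist_apply_le_dist (f := η₁) (g := η₂) (projIcc 0 T hT s)
    have h2 : ∫ s in (0 : ℝ)..t, Real.exp (k * s) * dist η₁ η₂
        = (Real.exp (k * t) - 1) / k * dist η₁ η₂ := by
      rw [intervalIntegral.integral_mul_const, intervalIntegral.integral_comp_mul_left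
        (fun x => Real.exp x) hk0.ne', integral_exp, mul_zero, Real.exp_zero, smul_eq_mul,
        inv_mul_eq_div]
    have h3 := (hG _ _ (hEc η₁) (hEc η₂) t ht).trans
      (mul_le_mul_of_nonneg_left (h1.trans h2.le) hK)
    have h4 : K / k ≤ 1 / 2 := by rw [div_le_div_iff₀ hk0 two_pos]; linarith
    calc dist (Φ η₁ t) (Φ η₂ t)
        = Real.exp (-(k * t)) * |G (E η₁) t - G (E η₂) t| := by
          rw [Real.dist_eq, hΦ]
          simp only [ContinuousMap.coe_mk]
          rw [← mul_sub, abs_mul, abs_of_pos (Real.exp_pos _)]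
      _ ≤ Real.exp (-(k * t)) * (K * ((Real.exp (k * t) - 1) / k * dist η₁ η₂)) := by gcongr
      _ ≤ Real.exp (-(k * t)) * (K * (Real.exp (k * t) / k * dist η₁ η₂)) := by
          gcongr
          linarith
      _ = (Real.exp (-(k * t)) * Real.exp (k * t)) * (K / k * dist η₁ η₂) := by ring
      _ = K / k * dist η₁ η₂ := by rw [← Real.exp_add, neg_add_cancel, Real.exp_zero, one_mul]
      _ ≤ (1 / 2 : ℝ≥0) * dist η₁ η₂ := by push_cast; gcongr
  obtain ⟨η, hη⟩ : ∃ η, Φ η = η := ⟨_, hcontr.fixedPoint_isFixedPt⟩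
  refine ⟨E η, hEc η, fun t ht => ?_⟩
  have h1 : Real.exp (-(k * t)) * G (E η) t = η ⟨t, ht⟩ := DFunLike.congr_fun hη ⟨t, ht⟩
  change Real.exp (k * t) * IccExtend hT η t = _
  rw [IccExtend_of_mem _ _ ht, ← h1, ← mul_assoc, ← Real.exp_add, add_neg_cancel, Real.exp_zero,
    one_mul]

section Linear

variable {c : ℝ → ℝ → ℝ} {L : ℝ≥0} {cmin cmax M : ℝ} {q₀ u : ℝ → ℝ}

/-- Existence for the linear transport equation. -/
theorem exists_weakForm (h : IsSpeed c L cmin cmax)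
    (hc : ∀ t x, x ≤ 0 → c t x = c t 0) (hT : 0 < T) (hℓ : 0 < ℓ) (hqm : Measurable q₀)
    (hum : Measurable u) (hq : ∀ x, |q₀ x| ≤ M) (hu : ∀ t, |u t| ≤ M) :
    ∃ q : ℝ → ℝ → ℝ, ContinuousInL1 T ℓ q ∧ (∀ t, Measurable (q t)) ∧
      (∃ B, ∀ t x, |q t x| ≤ B) ∧ WeakForm T ℓ c q₀ u q ∧
      ((∀ x, 0 ≤ q₀ x) → (∀ t, 0 ≤ u t) → ∀ t x, 0 ≤ q t x) ∧
      ∃ Z, IsFlow c Z ∧ ∀ t ∈ Icc 0 T, q t = transported Z (entryData (fun t => c t 0) q₀ u) t := by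
  obtain ⟨Z, hZ⟩ := h.exists_flow
  set a : ℝ → ℝ := fun t => c t 0
  set m : ℝ → ℝ := entryData a q₀ u
  have ha : Continuous a := h.continuous.comp (by fun_prop : Continuous fun t : ℝ => (t, (0 : ℝ)))
  have hmin : ∀ t, cmin ≤ a t := fun t => h.le t 0
  have hmax : ∀ t, a t ≤ cmax := fun t => h.ge t 0
  have hmm : Measurable m := measurable_entryData ha h.pos hmin hmax hqm hum
  have hmb := abs_entryData_le ha h.pos hmin hmax hq hu
  have hM : 0 ≤ M := (abs_nonneg _).trans (hq 0)
  set θ : ℝ → ℝ := fun t => projIcc 0 T hT.le t with hθ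
  have hθe : ∀ t ∈ Icc 0 T, θ t = t := fun t ht => by rw [hθ]; simp [projIcc_of_mem hT.le ht]
  have hθm : ∀ t, θ t ∈ Icc 0 T := fun t => (projIcc 0 T hT.le t).2
  refine ⟨fun t => transported Z m (θ t), ?_, fun t => hZ.measurable_transported h hmm _,
    ⟨(M + M * travelConst cmin cmax) * Real.exp (L * T), fun t x => ?_⟩, ?_, fun h1 h2 t x => ?_,
    Z, hZ, fun t ht => congrArg (transported Z m) (hθe t ht)⟩
  · intro s hs
    have h1 := hZ.continuousInL1_transported h hℓ.le (T := T) hmm hmb s hs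
    simp only [hθe s hs]
    refine ⟨h1.1, h1.2.congr' ?_⟩
    filter_upwards [self_mem_nhdsWithin] with t ht
    simp only [hθe t ht]
  · refine (hZ.abs_transported_le h hmb _ x).trans ?_
    gcongr
    rw [abs_of_nonneg (hθm t).1]
    exact (hθm t).2
  · intro φ hφ
    refine Eq.trans ?_ (hZ.weakForm_transported h hc hT hℓ hqm hum hq hu φ hφ)
    congr 2
    refine intervalIntegral.integral_congr fun t ht => ?_
    rw [uIcc_of_le hT.le] at ht
    simp only [hθe t ht]
    rfl
  · exact hZ.transported_nonneg h (entryData_nonneg ha h.pos hmin hmax h1 h2) _ x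

end Linear

section Mass

variable {a a₁ a₂ ρ₀ u : ℝ → ℝ} {amin amax M : ℝ}

/-- Mass on the road at time `t`, if the traffic moves with speed `a`. -/
noncomputable def roadMass (ℓ : ℝ) (ρ₀ u a : ℝ → ℝ) (t : ℝ) : ℝ :=
  (∫ x in (0 : ℝ)..max (ℓ - travel a t) 0, ρ₀ x)
    + ((∫ s in (0 : ℝ)..t, u s) - ∫ s in (0 : ℝ)..arrival a (max (travel a t - ℓ) 0), u s)

lemma abs_integral_sub_le {g : ℝ → ℝ} (hg : Measurable g) (hM : ∀ x, |g x| ≤ M) (x y : ℝ) :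
    |(∫ s in (0 : ℝ)..x, g s) - ∫ s in (0 : ℝ)..y, g s| ≤ M * |x - y| := by
  rw [intervalIntegral.integral_interval_sub_left
    (intervalIntegrable_of_measurable_of_bound hg hM _ _)
    (intervalIntegrable_of_measurable_of_bound hg hM _ _)]
  rw [← Real.norm_eq_abs]
  exact intervalIntegral.norm_integral_le_of_norm_le_const fun s _ => hM s

lemma continuous_integral_of_bound {g : ℝ → ℝ} (hg : Measurable g) (hM : ∀ x, |g x| ≤ M) :
    Continuous fun x => ∫ s in (0 : ℝ)..x, g s :=
  intervalIntegral.continuous_primitive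
    (fun _ _ => intervalIntegrable_of_measurable_of_bound hg hM _ _) 0

lemma continuous_roadMass (ha : Continuous a) (h0 : 0 < amin) (hmin : ∀ t, amin ≤ a t)
    (hmax : ∀ t, a t ≤ amax) (hρm : Measurable ρ₀) (hum : Measurable u)
    (hρ : ∀ x, |ρ₀ x| ≤ M) (hu : ∀ t, |u t| ≤ M) : Continuous (roadMass ℓ ρ₀ u a) := by
  have hbi := increasingBiLipschitz_travel ha h0 hmin hmax
  have h1 := hbi.lipschitz.continuous
  have h2 := hbi.lipschitz_inv.continuous
  have h3 := continuous_integral_of_bound hρm hρ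
  have h4 := continuous_integral_of_bound hum hu
  unfold roadMass
  exact (h3.comp (by fun_prop : Continuous fun t => max (ℓ - travel a t) 0)).add
    (h4.sub (h4.comp (by fun_prop : Continuous fun t => arrival a (max (travel a t - ℓ) 0))))

lemma arrival_mem (ha : Continuous a) (h0 : 0 < amin) (hmin : ∀ t, amin ≤ a t)
    (hmax : ∀ t, a t ≤ amax) (hℓ : 0 ≤ ℓ) {t : ℝ} (ht : 0 ≤ t) :
    arrival a (max (travel a t - ℓ) 0) ∈ Icc 0 t := by
  have hbi := increasingBiLipschitz_travel ha h0 hmin hmax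
  have htr0 : 0 ≤ travel a t := by
    simpa only [travel_zero] using hbi.strictMono.monotone ht
  constructor
  · have h1 := hbi.symm.strictMono.monotone (le_max_right (travel a t - ℓ) 0)
    rwa [show arrival a 0 = 0 by simpa only [travel_zero] using hbi.left_inv 0] at h1
  · conv_rhs => rw [← hbi.left_inv t]
    exact hbi.symm.strictMono.monotone (max_le (by linarith) htr0)

lemma roadMass_mem (ha : Continuous a) (h0 : 0 < amin) (hmin : ∀ t, amin ≤ a t)
    (hmax : ∀ t, a t ≤ amax) (hρm : Measurable ρ₀) (hum : Measurable u)
    (hρ : ∀ x, |ρ₀ x| ≤ M) (hu : ∀ t, |u t| ≤ M) (hρ0 : ∀ x, 0 ≤ ρ₀ x) (hu0 : ∀ t, 0 ≤ u t)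
    (hℓ : 0 ≤ ℓ) {t : ℝ} (ht : t ∈ Icc 0 T) :
    roadMass ℓ ρ₀ u a t ∈ Icc 0 (M * ℓ + M * T) := by
  have hbi := increasingBiLipschitz_travel ha h0 hmin hmax
  have htr0 : 0 ≤ travel a t := by
    simpa only [travel_zero] using hbi.strictMono.monotone ht.1
  have hM : 0 ≤ M := (abs_nonneg _).trans (hρ 0)
  have harr := arrival_mem ha h0 hmin hmax hℓ ht.1
  have h1 := (le_abs_self _).trans (abs_integral_sub_le hρm hρ (max (ℓ - travel a t) 0) 0)
  have h2 := (le_abs_self _).trans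
    (abs_integral_sub_le hum hu t (arrival a (max (travel a t - ℓ) 0)))
  have h3 : 0 ≤ ∫ x in (0 : ℝ)..max (ℓ - travel a t) 0, ρ₀ x :=
    intervalIntegral.integral_nonneg (le_max_right _ _) fun x _ => hρ0 x
  have h4 : 0 ≤ (∫ s in (0 : ℝ)..t, u s)
      - ∫ s in (0 : ℝ)..arrival a (max (travel a t - ℓ) 0), u s := by
    rw [intervalIntegral.integral_interval_sub_left
      (intervalIntegrable_of_measurable_of_bound hum hu _ _)
      (intervalIntegrable_of_measurable_of_bound hum hu _ _)]
    exact intervalIntegral.integral_nonneg harr.2 fun s _ => hu0 s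
  rw [intervalIntegral.integral_same, sub_zero, sub_zero, abs_of_nonneg (le_max_right _ _)] at h1
  rw [abs_of_nonneg (sub_nonneg.2 harr.2)] at h2
  have h5 : M * max (ℓ - travel a t) 0 ≤ M * ℓ := by
    gcongr
    exact max_le (by linarith) hℓ
  have h6 : M * (t - arrival a (max (travel a t - ℓ) 0)) ≤ M * T := by
    gcongr
    linarith [ht.2, harr.1]
  exact ⟨add_nonneg h3 h4, by rw [roadMass]; linarith⟩

lemma abs_roadMass_sub_le (ha₁ : Continuous a₁) (ha₂ : Continuous a₂) (h0 : 0 < amin)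
    (hmin₁ : ∀ t, amin ≤ a₁ t) (hmax₁ : ∀ t, a₁ t ≤ amax)
    (hmin₂ : ∀ t, amin ≤ a₂ t) (hmax₂ : ∀ t, a₂ t ≤ amax) (hρm : Measurable ρ₀)
    (hum : Measurable u) (hρ : ∀ x, |ρ₀ x| ≤ M) (hu : ∀ t, |u t| ≤ M) (hℓ : 0 ≤ ℓ) {t : ℝ}
    (ht : 0 ≤ t) :
    |roadMass ℓ ρ₀ u a₁ t - roadMass ℓ ρ₀ u a₂ t|
      ≤ (M + M * (2 / amin)) * ∫ s in (0 : ℝ)..t, |a₁ s - a₂ s| := by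
  have hbi₁ := increasingBiLipschitz_travel ha₁ h0 hmin₁ hmax₁
  have hbi₂ := increasingBiLipschitz_travel ha₂ h0 hmin₂ hmax₂
  have hM : 0 ≤ M := (abs_nonneg _).trans (hρ 0)
  set S : ℝ := ∫ s in (0 : ℝ)..t, |a₁ s - a₂ s| with hS
  have hi : ∀ b, IntervalIntegrable (fun s => |a₁ s - a₂ s|) volume 0 b := fun b =>
    (ha₁.sub ha₂).abs.intervalIntegrable _ _
  have htr : ∀ s ∈ Icc 0 t, |travel a₁ s - travel a₂ s| ≤ S := by
    intro s hs
    rw [travel, travel, ← intervalIntegral.integral_sub (ha₁.intervalIntegrable _ _)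
      (ha₂.intervalIntegrable _ _)]
    refine (intervalIntegral.abs_integral_le_integral_abs hs.1).trans ?_
    exact intervalIntegral.integral_mono_interval le_rfl hs.1 hs.2
      (Eventually.of_forall fun _ => abs_nonneg _) (hi t)
  have htt := htr t ⟨ht, le_rfl⟩
  set z₁ := max (travel a₁ t - ℓ) 0
  set z₂ := max (travel a₂ t - ℓ) 0
  have hz : |z₁ - z₂| ≤ S := by
    refine (abs_max_sub_max_le_abs _ _ _).trans ?_
    rwa [sub_sub_sub_cancel_right]
  have hy : |max (ℓ - travel a₁ t) 0 - max (ℓ - travel a₂ t) 0| ≤ S := by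
    refine (abs_max_sub_max_le_abs _ _ _).trans ?_
    rwa [sub_sub_sub_cancel_left, abs_sub_comm]
  have hτ : |arrival a₁ z₁ - arrival a₂ z₂| ≤ 2 / amin * S := by
    have h1 := (abs_travel_sub_le ha₁ h0.le hmin₁ hmax₁ (arrival a₂ z₂) (arrival a₁ z₁)).1
    rw [hbi₁.right_inv] at h1
    have h2 := htr _ (arrival_mem ha₂ h0 hmin₂ hmax₂ hℓ ht)
    rw [hbi₂.right_inv] at h2
    have h3 := abs_sub_le z₁ z₂ (travel a₁ (arrival a₂ z₂))
    rw [abs_sub_comm z₂] at h3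
    rw [div_mul_eq_mul_div, le_div_iff₀ h0]
    linarith
  have h1 := (abs_integral_sub_le hρm hρ _ _).trans (mul_le_mul_of_nonneg_left hy hM)
  have h2 := (abs_integral_sub_le hum hu _ _).trans (mul_le_mul_of_nonneg_left hτ hM)
  rw [roadMass, roadMass, show ∀ x y U p q : ℝ, x + (U - p) - (y + (U - q)) = (x - y) - (p - q) by
    intros; ring]
  refine (abs_sub _ _).trans ?_
  linarith

lemma integral_transported_eq_roadMass {Z : ℝ → ℝ → ℝ → ℝ} {L : ℝ≥0} (hZ : IsFlow (fun t _ => a t) Z)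
    (h : IsSpeed (fun t _ => a t) L amin amax) (hρm : Measurable ρ₀)
    (hum : Measurable u) (hρ : ∀ x, |ρ₀ x| ≤ M) (hu : ∀ t, |u t| ≤ M) (hℓ : 0 ≤ ℓ) {t : ℝ}
    (ht : 0 ≤ t) :
    ∫ y in (0 : ℝ)..ℓ, transported Z (entryData a ρ₀ u) t y = roadMass ℓ ρ₀ u a t := by
  have ha : Continuous a := h.continuous.comp (by fun_prop : Continuous fun t : ℝ => (t, (0 : ℝ)))
  have hmin : ∀ t, amin ≤ a t := fun t => h.le t 0
  have hmax : ∀ t, a t ≤ amax := fun t => h.ge t 0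
  have hbi := increasingBiLipschitz_travel ha h.pos hmin hmax
  have htr0 : 0 ≤ travel a t := by
    simpa only [travel_zero] using hbi.strictMono.monotone ht
  have har0 : arrival a 0 = 0 := by simpa only [travel_zero] using hbi.left_inv 0
  have hZ0 : ∀ y, Z 0 t y = y - travel a t := fun y => hZ.eq_sub_integral h 0 t y
  have hmi : ∀ x y, IntervalIntegrable (entryData a ρ₀ u) volume x y := fun _ _ =>
    intervalIntegrable_of_measurable_of_bound (measurable_entryData ha h.pos hmin hmax hρm hum)
      (abs_entryData_le ha h.pos hmin hmax hρ hu) _ _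
  have hin : ∀ s, 0 ≤ s → s ≤ travel a t →
      ∫ x in -travel a t..-s, entryData a ρ₀ u x = ∫ σ in arrival a s..t, u σ := by
    intro s hs hst
    have h1 := integral_entryData_neg (q₀ := ρ₀) (u := u) ha h.pos hmin hmax (fun _ => 1)
      hs hst
    simpa only [mul_one, hbi.left_inv] using h1
  rw [hZ.integral_transported h, hZ0, hZ0, zero_sub, roadMass]
  rcases le_total (travel a t) ℓ with hle | hle
  · rw [max_eq_left (sub_nonneg.2 hle), max_eq_right (sub_nonpos.2 hle), har0,
      intervalIntegral.integral_same, sub_zero,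
      ← intervalIntegral.integral_add_adjacent_intervals (hmi _ 0) (hmi 0 _)]
    have h1 := hin 0 le_rfl htr0
    rw [neg_zero, har0] at h1
    rw [h1, add_comm]
    congr 1
    refine intervalIntegral.integral_congr_ae (Eventually.of_forall fun x hx => ?_)
    rw [uIoc_of_le (sub_nonneg.2 hle)] at hx
    rw [entryData, if_pos hx.1]
  · rw [max_eq_right (sub_nonpos.2 hle), max_eq_left (sub_nonneg.2 hle),
      intervalIntegral.integral_same, zero_add]
    have h1 := hin _ (sub_nonneg.2 hle) (sub_le_self _ hℓ)
    rw [neg_sub] at h1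
    rw [h1, intervalIntegral.integral_interval_sub_left
      (intervalIntegrable_of_measurable_of_bound hum hu _ _)
      (intervalIntegrable_of_measurable_of_bound hum hu _ _)]

end Mass

end RoadTraffic

namespace RoadTraffic
open Filter Topology NNReal

variable {T ℓ : ℝ} {p : ℝ≥0∞}

section Data

/-- Essentially bounded data have bounded measurable representatives, defined everywhere. -/
lemma exists_bounded_representative {f : ℝ → ℝ} {a : ℝ}
    (hf : MemLp f ⊤ (volume.restrict (Icc (0 : ℝ) a))) :
    ∃ g : ℝ → ℝ, ∃ M, Measurable g ∧ (∀ x, |g x| ≤ M) ∧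
      (∀ᵐ x ∂(volume.restrict (Icc (0 : ℝ) a)), f x = g x) ∧
      ((∀ᵐ x ∂(volume.restrict (Icc (0 : ℝ) a)), 0 ≤ f x) → ∀ x, 0 ≤ g x) := by
  classical
  set μ := volume.restrict (Icc (0 : ℝ) a)
  set M : ℝ := (eLpNormEssSup f μ).toReal
  have hM : 0 ≤ M := ENNReal.toReal_nonneg
  have hfin : eLpNormEssSup f μ ≠ ⊤ := by
    have := hf.2
    rw [eLpNorm_exponent_top] at this
    exact this.ne
  have hfM : ∀ᵐ x ∂μ, |f x| ≤ M := by
    filter_upwards [ae_le_eLpNormEssSup (f := f) (μ := μ)] with x hx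
    rw [Real.enorm_eq_ofReal_abs] at hx
    exact (ENNReal.ofReal_le_iff_le_toReal hfin).1 hx
  set f' : ℝ → ℝ := hf.1.mk f
  have hf' : Measurable f' := hf.1.stronglyMeasurable_mk.measurable
  set m : ℝ := if ∀ᵐ x ∂μ, 0 ≤ f x then 0 else -M with hm
  have hm0 : m ≤ 0 := by rw [hm]; split_ifs <;> linarith
  have hmM : -M ≤ m := by rw [hm]; split_ifs <;> linarith
  have hmf : ∀ᵐ x ∂μ, m ≤ f x := by
    rw [hm]
    split_ifs with h
    · exact h
    · filter_upwards [hfM] with x hx using (abs_le.1 hx).1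
  refine ⟨fun x => max m (min M (f' x)), M, measurable_const.max (measurable_const.min hf'),
    fun x => abs_le.2 ⟨hmM.trans (le_max_left _ _), max_le (hm0.trans hM) (min_le_left _ _)⟩, ?_,
    fun h x => ?_⟩
  · filter_upwards [hfM, hmf, hf.1.ae_eq_mk] with x h1 h2 h3
    change f x = f' x at h3
    rw [← h3, min_eq_right (abs_le.1 h1).2, max_eq_right h2]
  · rw [show m = 0 from if_pos h]
    exact le_max_left _ _

lemma WeakForm.congr (hT : 0 ≤ T) (hℓ : 0 ≤ ℓ) {c c' r r' : ℝ → ℝ → ℝ} {r₀ r₀' u u' : ℝ → ℝ}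
    (h : WeakForm T ℓ c r₀ u r) (hc : ∀ t ∈ Icc 0 T, ∀ x ∈ Icc 0 ℓ, c' t x = c t x)
    (hr : ∀ t ∈ Icc 0 T, ∀ᵐ x ∂(volume.restrict (Icc (0 : ℝ) ℓ)), r' t x = r t x)
    (hr₀ : ∀ᵐ x ∂(volume.restrict (Icc (0 : ℝ) ℓ)), r₀' x = r₀ x)
    (hu : ∀ᵐ t ∂(volume.restrict (Icc (0 : ℝ) T)), u' t = u t) : WeakForm T ℓ c' r₀' u' r' := by
  intro φ hφ
  refine Eq.trans ?_ (h φ hφ)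
  congr 1
  · congr 1
    · refine intervalIntegral.integral_congr fun t ht => ?_
      rw [uIcc_of_le hT] at ht
      simp only [intervalIntegral_eq_integral_Icc hℓ]
      refine integral_congr_ae ?_
      filter_upwards [hr t ht, ae_restrict_mem measurableSet_Icc] with x h1 h2
      rw [h1, hc t ht x h2]
    · simp only [intervalIntegral_eq_integral_Icc hℓ]
      refine integral_congr_ae ?_
      filter_upwards [hr₀] with x h1
      rw [h1]
  · simp only [intervalIntegral_eq_integral_Icc hT]
    refine integral_congr_ae ?_
    filter_upwards [hu] with x h1
    rw [h1]

/-- Weak solutions that are bounded functions give weak solutions in `C([0, T]; L^p)`. -/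
lemma WeakForm.exists_satisfiesWeakly [Fact (1 ≤ p)] (hp : p ≠ ⊤) (hT : 0 ≤ T) (hℓ : 0 ≤ ℓ)
    {c r : ℝ → ℝ → ℝ} {r₀ u : ℝ → ℝ} {M : ℝ} (h : WeakForm T ℓ c r₀ u r)
    (hr : ContinuousInL1 T ℓ r) (hmeas : ∀ t, Measurable (r t)) (hM : ∀ t x, |r t x| ≤ M) :
    ∃ q : ℝ → RoadLp ℓ p, ContinuousOn q (Icc 0 T) ∧ SatisfiesWeakly T ℓ c r₀ u q ∧
      (∀ t, ∀ᵐ x ∂(volume.restrict (Icc (0 : ℝ) ℓ)), q t x = r t x) := by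
  have hq : ∀ t, ∀ᵐ x ∂(volume.restrict (Icc (0 : ℝ) ℓ)),
      (memLp_of_measurable_of_bound (p := p) (hmeas t) (hM t)).toLp (r t) x = r t x := fun t =>
    MemLp.coeFn_toLp _
  refine ⟨fun t => (memLp_of_measurable_of_bound (hmeas t) (hM t)).toLp (r t),
    continuousOn_toLp_of_continuousInL1 hp hℓ hr hmeas hM, ?_, hq⟩
  exact h.congr hT hℓ (fun _ _ _ _ => rfl) (fun t _ => hq t) (ae_of_all _ fun _ => rfl)
    (ae_of_all _ fun _ => rfl)

end Data

section Linear

/-- Well-posedness, existence part, for a linear conservation law on the road. -/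
theorem exists_satisfiesWeakly [Fact (1 ≤ p)] (hp : p ≠ ⊤) (hT : 0 < T) (hℓ : 0 < ℓ)
    {c : ℝ → ℝ → ℝ} (hc : ContinuousOn (fun z : ℝ × ℝ => c z.1 z.2) (Icc 0 T ×ˢ Icc 0 ℓ))
    {K : ℝ≥0} (hlip : ∀ t ∈ Icc 0 T, LipschitzOnWith K (c t) (Icc 0 ℓ))
    {cmin cmax : ℝ} (hcmin : 0 < cmin)
    (hb : ∀ t ∈ Icc 0 T, ∀ x ∈ Icc 0 ℓ, cmin ≤ c t x ∧ c t x ≤ cmax) {q₀ u : ℝ → ℝ}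
    (hq₀ : MemLp q₀ ⊤ (volume.restrict (Icc (0 : ℝ) ℓ)))
    (hu : MemLp u ⊤ (volume.restrict (Icc (0 : ℝ) T))) :
    ∃ q : ℝ → RoadLp ℓ p, ContinuousOn q (Icc 0 T) ∧ SatisfiesWeakly T ℓ c q₀ u q ∧
      IsEssBounded T ℓ q ∧ ((∀ᵐ x ∂(volume.restrict (Icc (0 : ℝ) ℓ)), 0 ≤ q₀ x) →
        (∀ᵐ t ∂(volume.restrict (Icc (0 : ℝ) T)), 0 ≤ u t) → ∀ t, 0 ≤ q t) := by
  obtain ⟨g, M, hgm, hgM, hgq, hg0⟩ := exists_bounded_representative hq₀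
  obtain ⟨w, N, hwm, hwN, hwu, hw0⟩ := exists_bounded_representative hu
  have hT' : ∀ t, (projIcc 0 T hT.le t : ℝ) ∈ Icc 0 T := fun t => (projIcc 0 T hT.le t).2
  have hℓ' : ∀ x, (projIcc 0 ℓ hℓ.le x : ℝ) ∈ Icc 0 ℓ := fun x => (projIcc 0 ℓ hℓ.le x).2
  have hs : IsSpeed (fun t x => c (projIcc 0 T hT.le t) (projIcc 0 ℓ hℓ.le x)) K cmin cmax := by
    refine ⟨?_, fun t => ?_, hcmin, fun t x => (hb _ (hT' t) _ (hℓ' x)).1,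
      fun t x => (hb _ (hT' t) _ (hℓ' x)).2⟩
    · exact hc.comp_continuous
        (f := fun z : ℝ × ℝ => ((projIcc 0 T hT.le z.1 : ℝ), (projIcc 0 ℓ hℓ.le z.2 : ℝ)))
        (((continuous_subtype_val.comp continuous_projIcc).comp continuous_fst).prodMk
          ((continuous_subtype_val.comp continuous_projIcc).comp continuous_snd))
        fun z => ⟨hT' _, hℓ' _⟩
    · refine LipschitzWith.of_dist_le_mul fun x y => ?_
      refine ((hlip _ (hT' t)).dist_le_mul _ (hℓ' x) _ (hℓ' y)).trans ?_
      gcongr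
      have h1 := (LipschitzWith.projIcc hℓ.le).dist_le_mul x y
      rwa [NNReal.coe_one, one_mul] at h1
  have hs0 : ∀ t x : ℝ, x ≤ 0 → c (projIcc 0 T hT.le t) (projIcc 0 ℓ hℓ.le x)
      = c (projIcc 0 T hT.le t) (projIcc 0 ℓ hℓ.le 0) := fun t x hx => by
    rw [projIcc_of_le_left hℓ.le hx, projIcc_of_le_left hℓ.le le_rfl]
  obtain ⟨r, hr, hrm, ⟨B, hB⟩, hw, hpos, -⟩ := exists_weakForm hs hs0 hT hℓ hgm hwm
    (fun x => (hgM x).trans (le_max_left M N)) (fun t => (hwN t).trans (le_max_right M N))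
  have hw' : WeakForm T ℓ c q₀ u r := by
    refine hw.congr hT.le hℓ.le (fun t ht x hx => ?_) (fun _ _ => ae_of_all _ fun _ => rfl) hgq hwu
    rw [projIcc_of_mem hT.le ht, projIcc_of_mem hℓ.le hx]
  obtain ⟨q, hqc, hqw, hqr⟩ := hw'.exists_satisfiesWeakly (p := p) hp hT.le hℓ.le hr hrm hB
  refine ⟨q, hqc, hqw, ⟨B, fun t _ => ?_⟩, fun h1 h2 t => ?_⟩
  · filter_upwards [hqr t] with x hx
    rw [hx]
    exact hB t x
  · rw [← Lp.coeFn_nonneg]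
    filter_upwards [hqr t] with x hx
    rw [hx]
    exact hpos (hg0 h1) (hw0 h2) t x

end Linear

section Traffic

variable {v : ℝ → ℝ → ℝ}

lemma exists_lipschitz_of_contDiffOn
    (hv : ContDiffOn ℝ 1 (fun z : ℝ × ℝ => v z.1 z.2) (Icc 0 T ×ˢ univ)) (R : ℝ) :
    ∃ K : ℝ≥0, ∀ t ∈ Icc 0 T, ∀ y ∈ Icc (-R) R, ∀ y' ∈ Icc (-R) R,
      |v t y - v t y'| ≤ K * |y - y'| := by
  obtain ⟨K, hK⟩ := (hv.mono (prod_mono_right (subset_univ (Icc (-R) R)))).exists_lipschitzOnWith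
    one_ne_zero ((convex_Icc 0 T).prod (convex_Icc (-R) R)) (isCompact_Icc.prod isCompact_Icc)
  refine ⟨K, fun t ht y hy y' hy' => ?_⟩
  have h1 := hK.dist_le_mul (t, y) ⟨ht, hy⟩ (t, y') ⟨ht, hy'⟩
  simpa [Prod.dist_eq, Real.dist_eq] using h1

lemma exists_bounds_of_pos (hT : 0 ≤ T)
    (hv : ContinuousOn (fun z : ℝ × ℝ => v z.1 z.2) (Icc 0 T ×ˢ univ))
    (hv_pos : ∀ t ∈ Icc 0 T, ∀ y : ℝ, 0 < v t y) {R : ℝ} (hR : 0 ≤ R) :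
    ∃ vmin vmax, 0 < vmin ∧ ∀ t ∈ Icc 0 T, ∀ y ∈ Icc (-R) R, vmin ≤ v t y ∧ v t y ≤ vmax := by
  have hc := hv.mono (prod_mono_right (subset_univ (Icc (-R) R)))
  have hcomp : IsCompact (Icc 0 T ×ˢ Icc (-R) R) := isCompact_Icc.prod isCompact_Icc
  have hne : (Icc 0 T ×ˢ Icc (-R) R).Nonempty := ⟨(0, 0), ⟨le_rfl, hT⟩, ⟨by linarith, hR⟩⟩
  obtain ⟨z, hz, hzmin⟩ := hcomp.exists_isMinOn hne hc
  obtain ⟨z', -, hzmax⟩ := hcomp.exists_isMaxOn hne hc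
  exact ⟨_, _, hv_pos z.1 hz.1 z.2, fun t ht y hy =>
    ⟨hzmin (a := (t, y)) ⟨ht, hy⟩, hzmax (a := (t, y)) ⟨ht, hy⟩⟩⟩

/-- Well-posedness, existence part, for the background traffic. -/
theorem exists_traffic [Fact (1 ≤ p)] (hp : p ≠ ⊤) (hT : 0 < T) (hℓ : 0 < ℓ)
    (hv : ContDiffOn ℝ 1 (fun z : ℝ × ℝ => v z.1 z.2) (Icc 0 T ×ˢ univ))
    (hv_pos : ∀ t ∈ Icc 0 T, ∀ y : ℝ, 0 < v t y) {ρ₀ u : ℝ → ℝ}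
    (hρ₀ : MemLp ρ₀ ⊤ (volume.restrict (Icc (0 : ℝ) ℓ)))
    (hu : MemLp u ⊤ (volume.restrict (Icc (0 : ℝ) T)))
    (hρ₀_nonneg : ∀ᵐ x ∂(volume.restrict (Icc (0 : ℝ) ℓ)), 0 ≤ ρ₀ x)
    (hu_nonneg : ∀ᵐ t ∂(volume.restrict (Icc (0 : ℝ) T)), 0 ≤ u t) :
    ∃ ρ : ℝ → RoadLp ℓ p, ContinuousOn ρ (Icc 0 T) ∧
      SatisfiesWeakly T ℓ (fun t _ => v t (∫ s in (0 : ℝ)..ℓ, ρ t s)) ρ₀ u ρ ∧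
      IsEssBounded T ℓ ρ ∧ ∀ t, 0 ≤ ρ t := by
  obtain ⟨g, M₁, hgm, hgM, hgq, hg0⟩ := exists_bounded_representative hρ₀
  obtain ⟨w, M₂, hwm, hwM, hwu, hw0⟩ := exists_bounded_representative hu
  replace hg0 := hg0 hρ₀_nonneg
  replace hw0 := hw0 hu_nonneg
  set M : ℝ := max M₁ M₂
  replace hgM : ∀ x, |g x| ≤ M := fun x => (hgM x).trans (le_max_left _ _)
  replace hwM : ∀ x, |w x| ≤ M := fun x => (hwM x).trans (le_max_right _ _)
  have hM : 0 ≤ M := (abs_nonneg _).trans (hgM 0)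
  set R : ℝ := M * ℓ + M * T
  have hR : 0 ≤ R := by positivity
  obtain ⟨K, hK⟩ := exists_lipschitz_of_contDiffOn hv R
  obtain ⟨vmin, vmax, hvmin, hvb⟩ := exists_bounds_of_pos hT.le hv.continuousOn hv_pos hR
  have hT' : ∀ t, (projIcc 0 T hT.le t : ℝ) ∈ Icc 0 T := fun t => (projIcc 0 T hT.le t).2
  have hR' : ∀ y, (projIcc 0 R hR y : ℝ) ∈ Icc (-R) R := fun y =>
    Icc_subset_Icc_left (neg_nonpos.2 hR) (projIcc 0 R hR y).2
  set a : (ℝ → ℝ) → ℝ → ℝ := fun m t => v (projIcc 0 T hT.le t) (projIcc 0 R hR (m t)) with ha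
  have hac : ∀ m, Continuous m → Continuous (a m) := fun m hm =>
    hv.continuousOn.comp_continuous
      (f := fun t : ℝ => ((projIcc 0 T hT.le t : ℝ), (projIcc 0 R hR (m t) : ℝ)))
      ((continuous_subtype_val.comp continuous_projIcc).prodMk
        ((continuous_subtype_val.comp continuous_projIcc).comp hm)) fun t => ⟨hT' _, mem_univ _⟩
  have hamin : ∀ m t, vmin ≤ a m t := fun m t => (hvb _ (hT' _) _ (hR' _)).1
  have hamax : ∀ m t, a m t ≤ vmax := fun m t => (hvb _ (hT' _) _ (hR' _)).2
  have halip : ∀ m₁ m₂ t, |a m₁ t - a m₂ t| ≤ K * |m₁ t - m₂ t| := fun m₁ m₂ t => by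
    refine (hK _ (hT' _) _ (hR' _) _ (hR' _)).trans ?_
    have h1 := (LipschitzWith.projIcc hR).dist_le_mul (m₁ t) (m₂ t)
    rw [NNReal.coe_one, one_mul] at h1
    exact mul_le_mul_of_nonneg_left h1 K.2
  obtain ⟨m, hm, hfix⟩ := exists_fixedPoint_volterra hT.le (G := fun m => roadMass ℓ g w (a m))
    (K := (M + M * (2 / vmin)) * K)
    (fun m hm => continuous_roadMass (hac m hm) hvmin (hamin m) (hamax m) hgm hwm hgM hwM)
    (by positivity) fun m₁ m₂ h₁ h₂ t ht => by
      refine (abs_roadMass_sub_le (hac _ h₁) (hac _ h₂) hvmin (hamin _) (hamax _) (hamin _)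
        (hamax _) hgm hwm hgM hwM hℓ.le ht.1).trans ?_
      have hC : 0 ≤ M + M * (2 / vmin) := by positivity
      rw [mul_assoc]
      refine mul_le_mul_of_nonneg_left ?_ hC
      rw [← intervalIntegral.integral_const_mul]
      refine intervalIntegral.integral_mono_on ht.1
        (((hac _ h₁).sub (hac _ h₂)).abs.intervalIntegrable _ _)
        ((continuous_const.mul (h₁.sub h₂).abs).intervalIntegrable _ _) fun s _ => halip _ _ s
  have hs : IsSpeed (fun t _ => a m t) 0 vmin vmax :=
    ⟨(hac m hm).comp continuous_fst, fun t => LipschitzWith.const _, hvmin, fun t _ => hamin m t,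
      fun t _ => hamax m t⟩
  obtain ⟨r, hr, hrm, ⟨B, hB⟩, hwf, hpos, Z, hZ, hrZ⟩ :=
    exists_weakForm hs (fun _ _ _ => rfl) hT hℓ hgm hwm hgM hwM
  have hmass : ∀ t ∈ Icc 0 T, ∫ x in (0 : ℝ)..ℓ, r t x = m t := fun t ht => by
    rw [hrZ t ht, hfix t ht]
    exact integral_transported_eq_roadMass hZ hs hgm hwm hgM hwM hℓ.le ht.1
  obtain ⟨ρ, hρc, hρw, hρr⟩ := hwf.exists_satisfiesWeakly (p := p) hp hT.le hℓ.le hr hrm hB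
  refine ⟨ρ, hρc, ?_, ⟨B, fun t _ => ?_⟩, fun t => ?_⟩
  · refine WeakForm.congr hT.le hℓ.le hρw (fun t ht x _ => ?_)
      (fun _ _ => ae_of_all _ fun _ => rfl) hgq hwu
    have h1 : ∫ s in (0 : ℝ)..ℓ, ρ t s = m t := by
      rw [← hmass t ht, intervalIntegral_eq_integral_Icc hℓ.le,
        intervalIntegral_eq_integral_Icc hℓ.le]
      exact integral_congr_ae (hρr t)
    have h2 : m t ∈ Icc 0 R := by
      rw [hfix t ht]
      exact roadMass_mem (hac m hm) hvmin (hamin m) (hamax m) hgm hwm hgM hwM hg0 hw0 hℓ.le ht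
    rw [h1, ha]
    simp only [projIcc_of_mem hT.le ht, projIcc_of_mem hR h2]
  · filter_upwards [hρr t] with x hx
    rw [hx]
    exact hB t x
  · rw [← Lp.coeFn_nonneg]
    filter_upwards [hρr t] with x hx
    rw [hx]
    exact hpos hg0 hw0 t x

/-- The background traffic is unique. -/
theorem traffic_unique [Fact (1 ≤ p)] (hT : 0 < T) (hℓ : 0 < ℓ)
    (hv : ContDiffOn ℝ 1 (fun z : ℝ × ℝ => v z.1 z.2) (Icc 0 T ×ˢ univ))
    (hv_pos : ∀ t ∈ Icc 0 T, ∀ y : ℝ, 0 < v t y) {ρ₀ u : ℝ → ℝ} {ρ ρ' : ℝ → RoadLp ℓ p}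
    (hρc : ContinuousOn ρ (Icc 0 T)) (hρc' : ContinuousOn ρ' (Icc 0 T))
    (hρ : SatisfiesWeakly T ℓ (fun t _ => v t (∫ s in (0 : ℝ)..ℓ, ρ t s)) ρ₀ u ρ)
    (hρ' : SatisfiesWeakly T ℓ (fun t _ => v t (∫ s in (0 : ℝ)..ℓ, ρ' t s)) ρ₀ u ρ')
    (hbd : IsEssBounded T ℓ ρ) : EqOn ρ' ρ (Icc 0 T) := by
  have h1 := continuousInL1_of_continuousOn hℓ.le hρc
  have h1' := continuousInL1_of_continuousOn hℓ.le hρc'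
  have hm := h1.continuousOn_integral hℓ.le
  have hm' := h1'.continuousOn_integral hℓ.le
  obtain ⟨R₁, hR₁⟩ := isCompact_Icc.exists_bound_of_continuousOn hm
  obtain ⟨R₂, hR₂⟩ := isCompact_Icc.exists_bound_of_continuousOn hm'
  set R : ℝ := max R₁ R₂
  have hmR : ∀ t ∈ Icc 0 T, ∫ s in (0 : ℝ)..ℓ, ρ t s ∈ Icc (-R) R := fun t ht =>
    abs_le.1 ((hR₁ t ht).trans (le_max_left _ _))
  have hmR' : ∀ t ∈ Icc 0 T, ∫ s in (0 : ℝ)..ℓ, ρ' t s ∈ Icc (-R) R := fun t ht =>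
    abs_le.1 ((hR₂ t ht).trans (le_max_right _ _))
  have hR : 0 ≤ R := (norm_nonneg _).trans ((hR₁ 0 ⟨le_rfl, hT.le⟩).trans (le_max_left _ _))
  obtain ⟨K, hK⟩ := exists_lipschitz_of_contDiffOn hv R
  obtain ⟨vmin, vmax, hvmin, hvb⟩ := exists_bounds_of_pos hT.le hv.continuousOn hv_pos hR
  obtain ⟨M, hM⟩ := hbd
  have hc : ∀ {m : ℝ → ℝ}, ContinuousOn m (Icc 0 T) →
      ContinuousOn (fun z : ℝ × ℝ => v z.1 (m z.1)) (Icc 0 T ×ˢ Icc 0 ℓ) := fun hm =>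
    hv.continuousOn.comp (continuousOn_fst.prodMk (hm.comp continuousOn_fst fun z hz => hz.1))
      fun z hz => ⟨hz.1, mem_univ _⟩
  intro t ht
  refine Lp.ext (WeakForm.ae_eq hT hℓ h1' h1 (hc hm') (hc hm) hρ' hρ (K := 0) (K' := K)
    (fun t _ => (LipschitzWith.const _).lipschitzOnWith) hvmin
    (fun t ht => (hvb t ht _ (hmR' t ht)).1) hM (fun t ht x _ => ?_) t ht)
  rw [intervalIntegral.integral_sub (h1' t ht).1 (h1 t ht).1]
  exact hK t ht _ (hmR' t ht) _ (hmR t ht)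

end Traffic

section Trucks

variable {lmin lmax L : ℝ} {lam : ℝ → ℝ → ℝ → ℝ}

/-- The Lipschitz bound of an admissible speed holds up to `y = 0`. -/
lemma abs_sub_le_of_mem_admissibleSpeeds (hlam : lam ∈ admissibleSpeeds T ℓ lmin lmax L)
    {t x x' y y' : ℝ} (ht : t ∈ Icc 0 T) (hx : x ∈ Icc 0 ℓ) (hx' : x' ∈ Icc 0 ℓ)
    (hy : 0 ≤ y) (hy' : 0 ≤ y') :
    |lam t x y - lam t x' y'| ≤ L * (|x - x'| + |y - y'|) := by
  obtain ⟨hc, -, hlip⟩ := hlam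
  have hlim : ∀ {x y : ℝ}, x ∈ Icc 0 ℓ → 0 ≤ y →
      Tendsto (fun ε => lam t x (y + ε)) (𝓝[>] 0) (𝓝 (lam t x y)) := by
    intro x y hx hy
    have h1 := hc (t, x, y) ⟨ht, hx, hy⟩
    refine Tendsto.comp (f := fun ε : ℝ => (t, x, y + ε)) h1 ?_
    refine tendsto_nhdsWithin_iff.2 ⟨?_, ?_⟩
    · have h2 : Continuous fun ε : ℝ => (t, x, y + ε) := by fun_prop
      simpa using (h2.tendsto 0).mono_left nhdsWithin_le_nhds
    · filter_upwards [self_mem_nhdsWithin] with ε hε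
      exact ⟨ht, hx, add_nonneg hy (le_of_lt hε)⟩
  refine le_of_tendsto ((hlim hx hy).sub (hlim hx' hy')).abs ?_
  filter_upwards [self_mem_nhdsWithin] with ε hε
  have h1 := hlip t ht t ht x hx x' hx' (y + ε) (add_pos_of_nonneg_of_pos hy hε) (y' + ε)
    (add_pos_of_nonneg_of_pos hy' hε)
  rwa [add_sub_add_right_eq_sub, sub_self, abs_zero, add_zero] at h1

variable {b d : ℝ → ℝ}

/-- Properties of the truck speed, for given background traffic. -/
lemma truck_speed [Fact (1 ≤ p)] (hℓ : 0 ≤ ℓ)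
    (hb : ContDiffOn ℝ 1 b (Icc 0 ℓ)) (hb_maps : MapsTo b (Icc 0 ℓ) (Icc 0 ℓ))
    (hd : ContDiffOn ℝ 1 d (Icc 0 ℓ)) (hd_maps : MapsTo d (Icc 0 ℓ) (Icc 0 ℓ))
    (hbd : ∀ x ∈ Icc 0 ℓ, b x ≤ d x) (hL : 0 ≤ L)
    (hlam : lam ∈ admissibleSpeeds T ℓ lmin lmax L) {ρ : ℝ → RoadLp ℓ p}
    (hρ : ContinuousOn ρ (Icc 0 T)) (hρ0 : ∀ t ∈ Icc 0 T, 0 ≤ ρ t) (hρb : IsEssBounded T ℓ ρ) :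
    ContinuousOn (fun z : ℝ × ℝ => lam z.1 z.2 (∫ s in (b z.2)..(d z.2), ρ z.1 s))
      (Icc 0 T ×ˢ Icc 0 ℓ) ∧
    (∃ K : ℝ≥0, ∀ t ∈ Icc 0 T,
      LipschitzOnWith K (fun x => lam t x (∫ s in (b x)..(d x), ρ t s)) (Icc 0 ℓ)) ∧
    ∀ t ∈ Icc 0 T, ∀ x ∈ Icc 0 ℓ, lmin ≤ lam t x (∫ s in (b x)..(d x), ρ t s) ∧
      lam t x (∫ s in (b x)..(d x), ρ t s) ≤ lmax := by
  have hc1 := continuousInL1_of_continuousOn hℓ hρ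
  have hF := hc1.continuousOn_primitive hℓ
  obtain ⟨M, hM⟩ := hρb
  have h0ℓ : (0 : ℝ) ∈ Icc 0 ℓ := ⟨le_rfl, hℓ⟩
  have hint : ∀ t ∈ Icc 0 T, ∀ x ∈ Icc 0 ℓ, ∀ y ∈ Icc 0 ℓ,
      IntervalIntegrable (ρ t) volume x y := fun t ht x hx y hy => IntervalIntegrable.mono_Icc hℓ (hc1 t ht).1 hx hy
  have hN0 : ∀ t ∈ Icc 0 T, ∀ x ∈ Icc 0 ℓ, 0 ≤ ∫ s in (b x)..(d x), ρ t s := by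
    intro t ht x hx
    refine intervalIntegral.integral_nonneg_of_ae_restrict (hbd x hx) ?_
    exact ae_restrict_of_ae_restrict_of_subset
      (Icc_subset_Icc (hb_maps hx).1 (hd_maps hx).2) ((Lp.coeFn_nonneg _).2 (hρ0 t ht))
  have hN : ∀ t ∈ Icc 0 T, ∀ x ∈ Icc 0 ℓ, ∫ s in (b x)..(d x), ρ t s
      = (∫ s in (0 : ℝ)..(d x), ρ t s) - ∫ s in (0 : ℝ)..(b x), ρ t s := fun t ht x hx =>
    (intervalIntegral.integral_interval_sub_left (hint t ht _ h0ℓ _ (hd_maps hx))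
      (hint t ht _ h0ℓ _ (hb_maps hx))).symm
  have hFd : ∀ {e : ℝ → ℝ}, ContinuousOn e (Icc 0 ℓ) → MapsTo e (Icc 0 ℓ) (Icc 0 ℓ) →
      ContinuousOn (fun z : ℝ × ℝ => ∫ s in (0 : ℝ)..(e z.2), ρ z.1 s) (Icc 0 T ×ˢ Icc 0 ℓ) :=
    fun he hem => ContinuousOn.comp (g := fun z : ℝ × ℝ => ∫ s in (0 : ℝ)..z.2, ρ z.1 s) hF
      (continuousOn_fst.prodMk (he.comp continuousOn_snd fun z hz => hz.2))
      fun z hz => ⟨hz.1, hem hz.2⟩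
  have hNc : ContinuousOn (fun z : ℝ × ℝ => ∫ s in (b z.2)..(d z.2), ρ z.1 s)
      (Icc 0 T ×ˢ Icc 0 ℓ) :=
    ((hFd hd.continuousOn hd_maps).sub (hFd hb.continuousOn hb_maps)).congr fun z hz =>
      hN z.1 hz.1 z.2 hz.2
  refine ⟨ContinuousOn.comp (g := fun z : ℝ × ℝ × ℝ => lam z.1 z.2.1 z.2.2) hlam.1
      (continuousOn_fst.prodMk (continuousOn_snd.prodMk hNc))
      fun z hz => ⟨hz.1, hz.2, hN0 z.1 hz.1 z.2 hz.2⟩, ?_,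
    fun t ht x hx => hlam.2.1 t ht x hx _ (hN0 t ht x hx)⟩
  obtain ⟨Kb, hKb⟩ := hb.exists_lipschitzOnWith one_ne_zero (convex_Icc 0 ℓ) isCompact_Icc
  obtain ⟨Kd, hKd⟩ := hd.exists_lipschitzOnWith one_ne_zero (convex_Icc 0 ℓ) isCompact_Icc
  have hFl : ∀ t ∈ Icc 0 T, ∀ x ∈ Icc 0 ℓ, ∀ y ∈ Icc 0 ℓ,
      |(∫ s in (0 : ℝ)..x, ρ t s) - ∫ s in (0 : ℝ)..y, ρ t s| ≤ |M| * |x - y| := by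
    intro t ht x hx y hy
    rw [intervalIntegral.integral_interval_sub_left (hint t ht _ h0ℓ _ hx) (hint t ht _ h0ℓ _ hy),
      ← Real.norm_eq_abs]
    refine intervalIntegral.norm_integral_le_of_norm_le_const_ae ?_
    have h1 := (ae_restrict_iff' measurableSet_Icc).1 (hM t ht)
    filter_upwards [h1] with s hs hsm
    exact (hs (uIcc_subset_Icc hy hx (uIoc_subset_uIcc hsm))).trans (le_abs_self M)
  refine ⟨⟨L * (1 + (|M| * Kd + |M| * Kb)), by positivity⟩, fun t ht =>
    LipschitzOnWith.of_dist_le_mul fun x hx y hy => ?_⟩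
  have h1 := abs_sub_le_of_mem_admissibleSpeeds hlam ht hx hy (hN0 t ht x hx) (hN0 t ht y hy)
  have h2 := (hFl t ht _ (hd_maps hx) _ (hd_maps hy)).trans
    (mul_le_mul_of_nonneg_left (hKd.dist_le_mul x hx y hy) (abs_nonneg M))
  have h3 := (hFl t ht _ (hb_maps hx) _ (hb_maps hy)).trans
    (mul_le_mul_of_nonneg_left (hKb.dist_le_mul x hx y hy) (abs_nonneg M))
  have h4 : |(∫ s in (b x)..(d x), ρ t s) - ∫ s in (b y)..(d y), ρ t s|
      ≤ (|M| * Kd + |M| * Kb) * |x - y| := by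
    rw [hN t ht x hx, hN t ht y hy, sub_sub_sub_comm]
    rw [Real.dist_eq] at h2 h3
    refine (abs_sub _ _).trans ?_
    linarith
  rw [Real.dist_eq, Real.dist_eq]
  refine h1.trans ?_
  calc L * (|x - y| + |(∫ s in (b x)..(d x), ρ t s) - ∫ s in (b y)..(d y), ρ t s|)
      ≤ L * (|x - y| + (|M| * Kd + |M| * Kb) * |x - y|) := by gcongr
    _ = L * (1 + (|M| * Kd + |M| * Kb)) * |x - y| := by ring

end Trucks

end RoadTraffic

theorem mainTheorem5
    (T ℓ : ℝ) (hT : 0 < T) (hℓ : 0 < ℓ)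
    (p : ℝ≥0∞) [Fact (1 ≤ p)] (hp : p ≠ ⊤)
    -- speed of the background traffic
    (v : ℝ → ℝ → ℝ)
    (hv : ContDiffOn ℝ 1 (fun z : ℝ × ℝ => v z.1 z.2) (Icc 0 T ×ˢ univ))
    (hv_pos : ∀ t ∈ Icc 0 T, ∀ y : ℝ, 0 < v t y)
    -- boundaries of the non-local term
    (b d : ℝ → ℝ)
    (hb : ContDiffOn ℝ 1 b (Icc 0 ℓ)) (hb_maps : MapsTo b (Icc 0 ℓ) (Icc 0 ℓ))
    (hd : ContDiffOn ℝ 1 d (Icc 0 ℓ)) (hd_maps : MapsTo d (Icc 0 ℓ) (Icc 0 ℓ))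
    (hbd : ∀ x ∈ Icc 0 ℓ, b x ≤ d x)
    -- speed of the trucks
    (lmin lmax L : ℝ) (hlmin : 0 < lmin) (hlmax : lmin ≤ lmax) (hL : 0 ≤ L)
    (lam : ℝ → ℝ → ℝ → ℝ) (hlam : lam ∈ admissibleSpeeds T ℓ lmin lmax L)
    -- initial data and inflows
    (ρ₀ q₀ u₁ u₂ : ℝ → ℝ)
    (hρ₀ : MemLp ρ₀ ⊤ (volume.restrict (Icc (0 : ℝ) ℓ)))
    (hq₀ : MemLp q₀ ⊤ (volume.restrict (Icc (0 : ℝ) ℓ)))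
    (hu₁ : MemLp u₁ ⊤ (volume.restrict (Icc (0 : ℝ) T)))
    (hu₂ : MemLp u₂ ⊤ (volume.restrict (Icc (0 : ℝ) T)))
    (hρ₀_nonneg : ∀ᵐ x ∂(volume.restrict (Icc (0 : ℝ) ℓ)), 0 ≤ ρ₀ x)
    (hu₁_nonneg : ∀ᵐ t ∂(volume.restrict (Icc (0 : ℝ) T)), 0 ≤ u₁ t) :
    ∃ ρ q : ℝ → RoadLp ℓ p,
      IsWeakSolution T ℓ v lam b d ρ₀ q₀ u₁ u₂ ρ q ∧
      (∀ ρ' q' : ℝ → RoadLp ℓ p, IsWeakSolution T ℓ v lam b d ρ₀ q₀ u₁ u₂ ρ' q' →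
        EqOn ρ' ρ (Icc 0 T) ∧ EqOn q' q (Icc 0 T)) ∧
      IsEssBounded T ℓ ρ ∧ IsEssBounded T ℓ q ∧
      (∀ t ∈ Icc 0 T, 0 ≤ ρ t) ∧
      ((∀ᵐ x ∂(volume.restrict (Icc (0 : ℝ) ℓ)), 0 ≤ q₀ x) →
        (∀ᵐ t ∂(volume.restrict (Icc (0 : ℝ) T)), 0 ≤ u₂ t) →
        ∀ t ∈ Icc 0 T, 0 ≤ q t) := by
  obtain ⟨ρ, hρc, hρw, hρb, hρ0⟩ := RoadTraffic.exists_traffic (p := p) hp hT hℓ hv hv_pos hρ₀ hu₁ hρ₀_nonneg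
    hu₁_nonneg
  obtain ⟨hcc, ⟨K, hlip⟩, hcb⟩ := RoadTraffic.truck_speed hℓ.le hb hb_maps hd hd_maps hbd hL hlam
    hρc (fun t _ => hρ0 t) hρb
  obtain ⟨q, hqc, hqw, hqb, hq0⟩ := RoadTraffic.exists_satisfiesWeakly (p := p) hp hT hℓ
    (c := fun t x => lam t x (∫ s in (b x)..(d x), ρ t s)) hcc hlip hlmin hcb hq₀ hu₂
  refine ⟨ρ, q, ⟨hρc, hqc, hρw, hqw⟩, fun ρ' q' h => ?_, hρb, hqb, fun t _ => hρ0 t,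
    fun h1 h2 t _ => hq0 h1 h2 t⟩
  have hρρ := RoadTraffic.traffic_unique hT hℓ hv hv_pos hρc h.continuous_traffic hρw h.traffic hρb
  refine ⟨hρρ, fun t ht => ?_⟩
  obtain ⟨M, hM⟩ := hqb
  have hqw' : RoadTraffic.WeakForm T ℓ (fun t x => lam t x (∫ s in (b x)..(d x), ρ t s)) q₀ u₂
      fun t x => q' t x := by
    refine RoadTraffic.WeakForm.congr hT.le hℓ.le h.truck (fun t ht x _ => ?_)
      (fun _ _ => ae_of_all _ fun _ => rfl) (ae_of_all _ fun _ => rfl) (ae_of_all _ fun _ => rfl)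
    rw [hρρ ht]
  exact Lp.ext (RoadTraffic.WeakForm.ae_eq hT hℓ
    (RoadTraffic.continuousInL1_of_continuousOn hℓ.le h.continuous_truck)
    (RoadTraffic.continuousInL1_of_continuousOn hℓ.le hqc) hcc hcc hqw' hqw hlip hlmin
    (fun t ht => (hcb t ht ℓ ⟨hℓ.le, le_rfl⟩).1) hM (K' := 0)
    (fun t _ x _ => by rw [sub_self, abs_zero, zero_mul]) t ht)
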